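/- Let $F$ be an algebraically closed field, let $\lambda=(\lambda_1,\dots,\lambda_l)$ with $\lambda_1\ge\lambda_2\ge\dots\ge\lambda_l\ge1$ be a partition of $n$, and let $B\in M_n(F)$ be a nilpotent matrix whose Jordan canonical form has blocks of sizes $\lambda_1,\dots,\lambda_l$. Let $\mathcal N_B$ be the set of all nilpotent $A\in M_n(F)$ with $AB=BA$, and for a partition $\mu$ of $n$ let $\mathcal O_\mu$ be the set of nilpotent matrices in $M_n(F)$ whose Jordan block sizes are the parts of $\mu$. Let $\mathcal D(\lambda)$ denote the unique partition $\mu$ of $n$ such that $\mathcal O_\mu\cap\mathcal N_B$ is Zariski dense in $\mathcal N_B$. A partition is called almost rectangular if its largest and smallest parts differ by at most one, and $r_\lambda$ denotes the smallest number $r$ such that $\lambda$ is a union (with multiplicities) of $r$ almost rectangular partitions. If $r_\lambda=2$, then $\mathcal D(\lambda)$ exists, is unique, and $$\mathcal D(\lambda)=(i_\lambda,\,n-i_\lambda),\qquad i_\lambda\ge n-i_\lambda\ge 1,$$ where $i_\lambda$ is the maximal index of nilpotency of an element of $\mathcal N_B$ (the index of nilpotency of $A$ being the smallest $k$ with $A^k=0$),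 and $$i_\lambda=\max\bigl\{\,2(i-1)+\lambda_i+\lambda_{i+1}+\dots+\lambda_{i+r}\;:\; 1\le i<l,\ r\ge0,\ i+r\le l,\ \lambda_i-\lambda_{i+r}\le1,\ \text{and } \lambda_{i-1}\ge2 \text{ if } i>1\,\bigr\}.$$ -/

import Mathlib

namespace NilpotentPairs

/-- The `j`-th part of a partition `lam`, for `j = 1, 2, 3, …`, the parts being listed in weakly
decreasing order; it is `0` when `j` exceeds the number of parts (the index `j = 0` is never
used). -/
def part {n : ℕ} (lam : n.Partition) (j : ℕ) : ℕ :=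
  (lam.parts.sort (· ≥ ·)).getD (j - 1) 0

/-- A multiset of parts is almost rectangular if its largest and its smallest part differ by at
most one. -/
def IsAlmostRectangular (s : Multiset ℕ) : Prop :=
  ∀ a ∈ s, ∀ b ∈ s, a ≤ b + 1

/-- `r_lam`: the smallest `r` such that `lam` is a union of `r` (nonempty) almost rectangular
partitions, the union being taken with multiplicities. -/
noncomputable def rNumber {n : ℕ} (lam : n.Partition) : ℕ :=
  sInf {r : ℕ | ∃ c : Fin r → Multiset ℕ,
    (∀ k, c k ≠ 0 ∧ IsAlmostRectangular (c k)) ∧ ∑ k, c k = lam.parts}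

/-- The nilpotent Jordan block of size `k`. -/
def jordanBlock (F : Type*) [Field F] (k : ℕ) : Matrix (Fin k) (Fin k) F :=
  Matrix.of fun a b => if (a : ℕ) + 1 = (b : ℕ) then 1 else 0

/-- The nilpotent Jordan matrix whose blocks have the parts of `lam` as their sizes. -/
def jordanMatrix (F : Type*) [Field F] {n : ℕ} (lam : n.Partition) :
    Matrix (Σ j : Fin lam.parts.card, Fin (part lam (j + 1)))
      (Σ j : Fin lam.parts.card, Fin (part lam (j + 1))) F :=
  Matrix.blockDiagonal' fun j : Fin lam.parts.card => jordanBlock F (part lam (j + 1))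

/-- The orbit of `lam`: all `n × n` matrices that are similar to the nilpotent Jordan matrix with
blocks `lam` (an indexing `e` of its rows and columns by `1, …, n` is chosen; any two choices give
similar matrices). -/
def nilpotentOrbit (F : Type*) [Field F] {n : ℕ} (lam : n.Partition) :
    Set (Matrix (Fin n) (Fin n) F) :=
  {A | ∃ (e : (Σ j : Fin lam.parts.card, Fin (part lam (j + 1))) ≃ Fin n)
      (P : GL (Fin n) F),
      A = (P : Matrix (Fin n) (Fin n) F) * Matrix.reindex e e (jordanMatrix F lam) *
        ((P⁻¹ : GL (Fin n) F) : Matrix (Fin n) (Fin n) F)}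

/-- `N_B`: the set of all nilpotent matrices that commute with `B`. -/
def nilpotentCommutator {F : Type*} [Field F] {n : ℕ} (B : Matrix (Fin n) (Fin n) F) :
    Set (Matrix (Fin n) (Fin n) F) :=
  {A | IsNilpotent A ∧ A * B = B * A}

/-- `S` is dense in `T` for the Zariski topology of the affine space of `n × n` matrices:
`T` is contained in the Zariski closure of `S`, that is, every polynomial in the matrix entries
that vanishes on `S` vanishes on `T`. -/
def ZariskiDenseIn {F : Type*} [Field F] {n : ℕ} (S T : Set (Matrix (Fin n) (Fin n) F)) : Prop :=
  ∀ p : MvPolynomial (Fin n × Fin n) F,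
    (∀ A ∈ S, MvPolynomial.eval (fun ij => A ij.1 ij.2) p = 0) →
      ∀ A ∈ T, MvPolynomial.eval (fun ij => A ij.1 ij.2) p = 0

/-- The property defining `D(lam)`, for `B` in the orbit of `lam`: `mu = D(lam)` is the partition
for which the intersection of the orbit of `mu` with `N_B` is dense in `N_B`. -/
def IsGenericPartition {F : Type*} [Field F] {n : ℕ} (B : Matrix (Fin n) (Fin n) F)
    (mu : n.Partition) : Prop :=
  ZariskiDenseIn (nilpotentOrbit F mu ∩ nilpotentCommutator B) (nilpotentCommutator B)

/-- The numbers `2 (i - 1) + lam_i + ⋯ + lam_{i + r}`, where `1 ≤ i < l` (with `l` the number of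
parts of `lam`), `r ≥ 0`, `i + r ≤ l`, `lam_i - lam_{i + r} ≤ 1`, and `lam_{i - 1} ≥ 2` in case
`i > 1`. -/
def indexCandidates {n : ℕ} (lam : n.Partition) : Set ℕ :=
  {m | ∃ i r : ℕ, 1 ≤ i ∧ i < lam.parts.card ∧ i + r ≤ lam.parts.card ∧
    part lam i ≤ part lam (i + r) + 1 ∧ (1 < i → 2 ≤ part lam (i - 1)) ∧
    m = 2 * (i - 1) + ∑ j ∈ Finset.Icc i (i + r), part lam j}

end NilpotentPairs

namespace NilpotentPairs

open Module Polynomial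

/-! ### Jordan chains and the Jordan type of an operator -/

section JordanType

variable {F : Type*} [Field F] {V W : Type*} [AddCommGroup V] [Module F V]
  [AddCommGroup W] [Module F W] {ι κ : Type*}

/-! Regard $B$ as an operator $T$ of Jordan type $\lambda$, and let $M$ be the maximum over $e\ge1$
of `chainLength`: blocks smaller than $e$ count 0, blocks of sizes $e$ and $e+1$ count fully, larger
blocks count 2. This $M$ is the maximal index of nilpotency $i_\lambda$.

Upper bound: filter $V$ by the subspaces $\operatorname{im}T^x\cap\ker T^y$. A nilpotent $A$
commuting with $T$ acts on each graded piece, whose dimension is at most the multiplicity of the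
part $x+y$. Bounding the total cost of all descents through the filtration gives $A^M=0$
(`pow_apply_eq_zero_of_mem_range_inf_ker`, `HasJordanType.pow_eq_zero_of_commute`). Lower bound: one
long chain runs through all blocks of sizes $e$ and $e+1$, and each larger block lets it be extended
by two vectors (`exists_commute_prod_pow_ne_zero`). Elementary comparison of sums identifies $M$
with the largest element of `indexCandidates`; this uses that $\lambda$ is a union of two almost
rectangular partitions.

Number of blocks: a commuting nilpotent operator with a single block would force $\lambda$ to be
almost rectangular, so $r_\lambda=2$ gives $\dim\ker A\ge2$ on all of $\mathcal N_B$, while the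
splitting of $\lambda$ into two almost rectangular pieces gives a point with $\dim\ker A\le2$. A
point with $A^{M-1}\ne0$ and $\dim\ker A\le2$ therefore has type $(M,n-M)$.

Density: both conditions are open. In the centralizer of $B$ there is a linear space of nilpotents
meeting every nilpotent conjugacy class (`exists_submodule_isNilpotent`). On a line in it, finitely
many nonzero polynomials have a common non-zero, so both conditions can be met together, and off the
zero set of any polynomial not vanishing on $\mathcal N_B$
(`exists_generic_of_nilpotentCommutator`). -/

lemma prodMap_pow (T : End F V) (T' : End F W) (k : ℕ) :
    (T.prodMap T') ^ k = (T ^ k).prodMap (T' ^ k) := by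
  induction k with
  | zero => rw [pow_zero, pow_zero, pow_zero, LinearMap.prodMap_one]
  | succ k ih => rw [pow_succ, ih, LinearMap.prodMap_mul, ← pow_succ, ← pow_succ]

/-- Vectors `g j` are generators of Jordan chains for `T`, the chain of `g j` having length `l j`,
that together form a basis of the space. -/
structure IsJordanSystem (T : End F V) (l : ι → ℕ) (g : ι → V) : Prop where
  pow_eq_zero : ∀ j, (T ^ l j) (g j) = 0
  linearIndependent :
    LinearIndependent F (fun x : Σ j, Fin (l j) => (T ^ (x.2 : ℕ)) (g x.1))
  span_eq_top : ⊤ ≤ Submodule.span F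
    (Set.range (fun x : Σ j, Fin (l j) => (T ^ (x.2 : ℕ)) (g x.1)))

/-- `T` is a nilpotent operator whose Jordan blocks have the sizes in `s`. -/
def HasJordanType (T : End F V) (s : Multiset ℕ) : Prop :=
  ∃ (ι : Type) (_ : Fintype ι) (l : ι → ℕ) (g : ι → V),
    IsJordanSystem T l g ∧ Finset.univ.val.map l = s

namespace IsJordanSystem

variable {T : End F V} {l : ι → ℕ} {g : ι → V}

/-- The basis formed by the Jordan chains. -/
noncomputable def basis (h : IsJordanSystem T l g) : Basis (Σ j, Fin (l j)) F V :=
  Basis.mk h.linearIndependent h.span_eq_top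

lemma basis_apply (h : IsJordanSystem T l g) (j : ι) (k : Fin (l j)) :
    h.basis ⟨j, k⟩ = (T ^ (k : ℕ)) (g j) := by
  simp [basis]

lemma pow_eq_zero_of_le (h : IsJordanSystem T l g) {j : ι} {k : ℕ} (hk : l j ≤ k) :
    (T ^ k) (g j) = 0 := by
  obtain ⟨m, rfl⟩ := Nat.exists_eq_add_of_le' hk
  rw [pow_add, Module.End.mul_apply, h.pow_eq_zero, map_zero]

lemma pow_ne_zero (h : IsJordanSystem T l g) {j : ι} {k : ℕ} (hk : k < l j) :
    (T ^ k) (g j) ≠ 0 := by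
  have := h.basis.ne_zero ⟨j, ⟨k, hk⟩⟩
  rwa [h.basis_apply] at this

lemma map_ext (h : IsJordanSystem T l g) {L L' : V →ₗ[F] W}
    (hL : ∀ j k, k < l j → L ((T ^ k) (g j)) = L' ((T ^ k) (g j))) : L = L' := by
  refine h.basis.ext fun ⟨j, k⟩ => ?_
  rw [h.basis_apply]
  exact hL j k k.2

lemma intertwine_pow {T' : End F W} {L : V →ₗ[F] W} (hL : ∀ x, L (T x) = T' (L x)) (k : ℕ)
    (x : V) : L ((T ^ k) x) = (T' ^ k) (L x) := by
  induction k generalizing x with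
  | zero => simp
  | succ k ih => rw [pow_succ, Module.End.mul_apply, ih, hL, pow_succ, Module.End.mul_apply]

/-- Universal property of $\bigoplus_j F[X]/(X^{l_j})$: a module map out of it amounts to a choice
of images of the generators that respect their orders. All commuting operators below are built this
way. -/
lemma exists_lift (h : IsJordanSystem T l g) (T' : End F W) (w : ι → W)
    (hw : ∀ j, (T' ^ l j) (w j) = 0) :
    ∃ L : V →ₗ[F] W, (∀ x, L (T x) = T' (L x)) ∧ ∀ j, L (g j) = w j := by
  have hw' : ∀ j k, l j ≤ k → (T' ^ k) (w j) = 0 := by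
    intro j k hk
    obtain ⟨m, rfl⟩ := Nat.exists_eq_add_of_le' hk
    rw [pow_add, Module.End.mul_apply, hw, map_zero]
  let L : V →ₗ[F] W := h.basis.constr F fun x => (T' ^ (x.2 : ℕ)) (w x.1)
  have hL : ∀ j k, L ((T ^ k) (g j)) = (T' ^ k) (w j) := by
    intro j k
    rcases lt_or_ge k (l j) with hk | hk
    · have := h.basis.constr_basis F (fun x => (T' ^ (x.2 : ℕ)) (w x.1)) ⟨j, ⟨k, hk⟩⟩
      rwa [h.basis_apply] at this
    · rw [h.pow_eq_zero_of_le hk, hw' j k hk, map_zero]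
  refine ⟨L, fun x => ?_, fun j => by simpa using hL j 0⟩
  have : L ∘ₗ T = T' ∘ₗ L := h.map_ext fun j k _ => by
    simp only [LinearMap.comp_apply]
    rw [hL, ← Module.End.mul_apply, ← Module.End.mul_apply, ← pow_succ', ← pow_succ', hL]
  exact LinearMap.congr_fun this x

lemma map_ext_of_intertwine (h : IsJordanSystem T l g) {T' : End F W} {L L' : V →ₗ[F] W}
    (hL : ∀ x, L (T x) = T' (L x)) (hL' : ∀ x, L' (T x) = T' (L' x))
    (hg : ∀ j, L (g j) = L' (g j)) : L = L' :=
  h.map_ext fun j k _ => by rw [intertwine_pow hL, intertwine_pow hL', hg]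

lemma map_equiv (h : IsJordanSystem T l g) (e : V ≃ₗ[F] W) {T' : End F W}
    (he : ∀ x, e (T x) = T' (e x)) : IsJordanSystem T' l (fun j => e (g j)) := by
  have key : ∀ k j, (T' ^ k) (e (g j)) = e ((T ^ k) (g j)) := fun k j =>
    (intertwine_pow (L := (e : V →ₗ[F] W)) he k (g j)).symm
  have hfun : (fun x : Σ j, Fin (l j) => (T' ^ (x.2 : ℕ)) (e (g x.1))) =
      fun x => h.basis.map e x := by
    funext ⟨j, k⟩
    rw [Basis.map_apply, h.basis_apply, key]
  refine ⟨fun j => by rw [key, h.pow_eq_zero, map_zero], ?_, ?_⟩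
  · rw [hfun]; exact (h.basis.map e).linearIndependent
  · rw [hfun]; exact (h.basis.map e).span_eq.ge

lemma reindex (h : IsJordanSystem T l g) (e : κ ≃ ι) :
    IsJordanSystem T (fun j => l (e j)) (fun j => g (e j)) := by
  let e' : (Σ j, Fin (l (e j))) ≃ Σ j, Fin (l j) := Equiv.sigmaCongrLeft (β := fun j => Fin (l j)) e
  have hfun : (fun x : Σ j, Fin (l (e j)) => (T ^ (x.2 : ℕ)) (g (e x.1))) =
      fun x => h.basis.reindex e'.symm x := by
    funext ⟨j, k⟩
    rw [Basis.reindex_apply, Equiv.symm_symm]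
    exact (h.basis_apply (e j) k).symm
  refine ⟨fun j => h.pow_eq_zero _, ?_, ?_⟩
  · rw [hfun]; exact (h.basis.reindex e'.symm).linearIndependent
  · rw [hfun]; exact (h.basis.reindex e'.symm).span_eq.ge

lemma prod (h : IsJordanSystem T l g) {T' : End F W} {l' : κ → ℕ} {g' : κ → W}
    (h' : IsJordanSystem T' l' g') :
    IsJordanSystem (T.prodMap T') (Sum.elim l l')
      (Sum.elim (fun j => (g j, (0 : W))) fun j => ((0 : V), g' j)) := by
  have key : ∀ (k : ℕ) (x : V × W), ((T.prodMap T') ^ k) x = ((T ^ k) x.1, (T' ^ k) x.2) := by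
    intro k x
    rw [prodMap_pow]; rfl
  let e' : (Σ j, Fin (Sum.elim l l' j)) ≃ (Σ j, Fin (l j)) ⊕ (Σ j, Fin (l' j)) :=
    Equiv.sumSigmaDistrib _
  let b := (h.basis.prod h'.basis).reindex e'.symm
  have hfun : (fun x : Σ j, Fin (Sum.elim l l' j) => ((T.prodMap T') ^ (x.2 : ℕ))
      (Sum.elim (fun j => (g j, (0 : W))) (fun j => ((0 : V), g' j)) x.1)) = fun x => b x := by
    funext ⟨j, k⟩
    rcases j with j | j
    · rw [key, Basis.reindex_apply, Equiv.symm_symm]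
      have : e' ⟨Sum.inl j, k⟩ = Sum.inl ⟨j, k⟩ := rfl
      rw [this]
      ext
      · simpa using (h.basis_apply j k).symm
      · simp
    · rw [key, Basis.reindex_apply, Equiv.symm_symm]
      have : e' ⟨Sum.inr j, k⟩ = Sum.inr ⟨j, k⟩ := rfl
      rw [this]
      ext
      · simp
      · simpa using (h'.basis_apply j k).symm
  refine ⟨?_, ?_, ?_⟩
  · rintro (j | j)
    · simp [key, h.pow_eq_zero]
    · simp [key, h'.pow_eq_zero]
  · rw [hfun]; exact b.linearIndependent
  · rw [hfun]; exact b.span_eq.ge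

lemma finrank_eq [Fintype ι] (h : IsJordanSystem T l g) : finrank F V = ∑ j, l j := by
  rw [finrank_eq_card_basis h.basis]
  simp

lemma card_le_finrank_ker [Fintype ι] [FiniteDimensional F V] (h : IsJordanSystem T l g)
    (hl : ∀ j, 0 < l j) : Fintype.card ι ≤ finrank F (LinearMap.ker T) := by
  have hmem : ∀ j, (T ^ (l j - 1)) (g j) ∈ LinearMap.ker T := by
    intro j
    rw [LinearMap.mem_ker, ← Module.End.mul_apply, ← pow_succ', Nat.sub_add_cancel (hl j),
      h.pow_eq_zero]
  have hli : LinearIndependent F fun j => (⟨_, hmem j⟩ : LinearMap.ker T) := by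
    apply LinearIndependent.of_comp (LinearMap.ker T).subtype
    have := h.linearIndependent.comp
      (fun j => (⟨j, ⟨l j - 1, Nat.sub_lt (hl j) one_pos⟩⟩ : Σ j, Fin (l j)))
      (fun a b hab => congrArg Sigma.fst hab)
    exact this
  exact hli.fintype_card_le_finrank

lemma finrank_ker_le_card [Fintype ι] [FiniteDimensional F V] (h : IsJordanSystem T l g) :
    finrank F (LinearMap.ker T) ≤ Fintype.card ι := by
  have htop : LinearMap.range T ⊔ Submodule.span F (Set.range g) = ⊤ := by
    rw [eq_top_iff, ← h.basis.span_eq, Submodule.span_le]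
    rintro _ ⟨⟨j, k⟩, rfl⟩
    rw [h.basis_apply]
    rcases Nat.eq_zero_or_pos (k : ℕ) with hk | hk
    · rw [hk]
      exact Submodule.mem_sup_right (Submodule.subset_span ⟨j, rfl⟩)
    · refine Submodule.mem_sup_left ⟨(T ^ ((k : ℕ) - 1)) (g j), ?_⟩
      rw [← Module.End.mul_apply, ← pow_succ', Nat.sub_add_cancel hk]
  have h1 := Submodule.finrank_add_le_finrank_add_finrank (LinearMap.range T)
    (Submodule.span F (Set.range g))
  rw [htop, finrank_top] at h1
  have h2 := LinearMap.finrank_range_add_finrank_ker T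
  have h3 := finrank_range_le_card (R := F) g
  rw [Set.finrank] at h3
  omega

end IsJordanSystem

/-- Fibres over each value have equal cardinality, and the bijections between fibres glue. -/
lemma exists_equiv_of_map_univ_eq [Fintype ι] [Fintype κ] {α : Type*} {l : ι → α} {l' : κ → α}
    (h : Finset.univ.val.map l = Finset.univ.val.map l') : ∃ e : κ ≃ ι, ∀ j, l (e j) = l' j := by
  classical
  have hcard : ∀ a, Nonempty ({j // l' j = a} ≃ {j // l j = a}) := by
    intro a
    refine ⟨Fintype.equivOfCardEq ?_⟩
    have := congrArg (Multiset.count a) h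
    rw [Multiset.count_map, Multiset.count_map] at this
    rw [Fintype.card_subtype, Fintype.card_subtype, Finset.card_def, Finset.card_def,
      Finset.filter_val, Finset.filter_val]
    simpa only [eq_comm] using this.symm
  let E := fun a => (hcard a).some
  refine ⟨(Equiv.sigmaFiberEquiv l').symm.trans
    ((Equiv.sigmaCongrRight E).trans (Equiv.sigmaFiberEquiv l)), fun j => ?_⟩
  exact (E (l' j) ⟨j, rfl⟩).2

namespace HasJordanType

variable {T : End F V} {T' : End F W} {s s' : Multiset ℕ}

lemma exists_system (h : HasJordanType T s) [Fintype κ] {l : κ → ℕ}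
    (hl : Finset.univ.val.map l = s) : ∃ g : κ → V, IsJordanSystem T l g := by
  obtain ⟨ι, _, l', g, hg, hs⟩ := h
  obtain ⟨e, he⟩ := exists_equiv_of_map_univ_eq (hs.trans hl.symm)
  obtain rfl : (fun j => l' (e j)) = l := funext he
  exact ⟨_, hg.reindex e⟩

lemma of_equiv (h : HasJordanType T s) (e : V ≃ₗ[F] W) (he : ∀ x, e (T x) = T' (e x)) :
    HasJordanType T' s := by
  obtain ⟨ι, _, l, g, hg, hs⟩ := h
  exact ⟨ι, _, l, _, hg.map_equiv e he, hs⟩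

lemma prod (h : HasJordanType T s) (h' : HasJordanType T' s') :
    HasJordanType (T.prodMap T') (s + s') := by
  obtain ⟨ι, _, l, g, hg, rfl⟩ := h
  obtain ⟨κ, _, l', g', hg', rfl⟩ := h'
  refine ⟨ι ⊕ κ, inferInstance, _, _, hg.prod hg', ?_⟩
  simp [← Finset.univ_disjSum_univ, Finset.disjSum, Multiset.disjSum, Multiset.map_map]

lemma exists_equiv (h : HasJordanType T s) (h' : HasJordanType T' s) :
    ∃ e : V ≃ₗ[F] W, ∀ x, e (T x) = T' (e x) := by
  obtain ⟨ι, _, l, g, hg, hs⟩ := h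
  obtain ⟨g', hg'⟩ := h'.exists_system hs
  obtain ⟨L, hL, hLg⟩ := hg.exists_lift T' g' hg'.pow_eq_zero
  obtain ⟨L', hL', hLg'⟩ := hg'.exists_lift T g hg.pow_eq_zero
  have h1 : L' ∘ₗ L = LinearMap.id := hg.map_ext_of_intertwine (T' := T)
    (by simp [hL, hL']) (by simp) (by simp [hLg, hLg'])
  have h2 : L ∘ₗ L' = LinearMap.id := hg'.map_ext_of_intertwine (T' := T')
    (by simp [hL, hL']) (by simp) (by simp [hLg, hLg'])
  exact ⟨LinearEquiv.ofLinearMap L L' h2 h1, hL⟩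

lemma finrank_eq (h : HasJordanType T s) : finrank F V = s.sum := by
  obtain ⟨ι, _, l, g, hg, rfl⟩ := h
  exact hg.finrank_eq

lemma finite (h : HasJordanType T s) : FiniteDimensional F V := by
  obtain ⟨ι, _, l, g, hg, rfl⟩ := h
  exact Module.Finite.of_basis hg.basis

lemma pow_eq_zero_iff (h : HasJordanType T s) {k : ℕ} : T ^ k = 0 ↔ ∀ p ∈ s, p ≤ k := by
  obtain ⟨ι, _, l, g, hg, rfl⟩ := h
  simp only [Multiset.mem_map, Finset.mem_val, Finset.mem_univ, true_and, forall_exists_index,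
    forall_apply_eq_imp_iff]
  refine ⟨fun hT j => ?_, fun hk => hg.map_ext fun j i _ => ?_⟩
  · by_contra! hlt
    exact hg.pow_ne_zero hlt (by rw [hT]; rfl)
  · rw [← Module.End.mul_apply, ← pow_add, hg.pow_eq_zero_of_le ((hk j).trans (by omega))]
    rfl

lemma isNilpotent (h : HasJordanType T s) : IsNilpotent T :=
  ⟨s.sum, h.pow_eq_zero_iff.2 fun _ hp => Multiset.single_le_sum (fun _ _ => Nat.zero_le _) _ hp⟩

lemma finrank_ker (h : HasJordanType T s) (hs : ∀ p ∈ s, 0 < p) :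
    finrank F (LinearMap.ker T) = Multiset.card s := by
  have := h.finite
  obtain ⟨ι, _, l, g, hg, rfl⟩ := h
  have h1 := hg.finrank_ker_le_card
  have h2 := hg.card_le_finrank_ker (by simpa using hs)
  rw [Multiset.card_map]
  exact le_antisymm h1 h2

end HasJordanType

end JordanType

/-! ### Existence of the Jordan type, and orbits described by Jordan type -/

section JordanExistence

variable {F : Type*} [Field F] {V W : Type*} [AddCommGroup V] [Module F V]
  [AddCommGroup W] [Module F W] {ι κ : Type*}

lemma IsJordanSystem.of_basis {T : End F V} {l : ι → ℕ} {g : ι → V}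
    (b : Basis (Σ j, Fin (l j)) F V) (h0 : ∀ j, (T ^ l j) (g j) = 0)
    (hb : ∀ x : Σ j, Fin (l j), b x = (T ^ (x.2 : ℕ)) (g x.1)) : IsJordanSystem T l g := by
  have hfun : (fun x : Σ j, Fin (l j) => (T ^ (x.2 : ℕ)) (g x.1)) = fun x => b x :=
    funext fun x => (hb x).symm
  refine ⟨h0, ?_, ?_⟩
  · rw [hfun]; exact b.linearIndependent
  · rw [hfun]; exact b.span_eq.ge

section Model

variable [Fintype ι] [DecidableEq ι]

lemma blockDiagonal_jordanBlock_single (l : ι → ℕ) (j : ι) (a : Fin (l j)) :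
    Matrix.toLin' (Matrix.blockDiagonal' fun j => jordanBlock F (l j))
      (Pi.single (⟨j, a⟩ : Σ j, Fin (l j)) 1) =
    if 0 < (a : ℕ) then Pi.single ⟨j, ⟨a - 1, by omega⟩⟩ 1 else 0 := by
  rw [Matrix.toLin'_apply, Matrix.mulVec_single_one]
  funext ⟨i, c⟩
  rw [Matrix.col_apply]
  by_cases hij : i = j
  · subst hij
    rw [Matrix.blockDiagonal'_apply_eq, jordanBlock, Matrix.of_apply]
    by_cases h : (c : ℕ) + 1 = a
    · have hc : c = ⟨a - 1, by omega⟩ := Fin.ext (by simp; omega)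
      rw [if_pos h, if_pos (by omega), ← hc, Pi.single_eq_same]
    · rw [if_neg h]
      split_ifs with ha
      · rw [Pi.single_eq_of_ne]
        intro heq
        obtain ⟨_, h2⟩ := Sigma.mk.inj heq
        have := congrArg Fin.val (eq_of_heq h2)
        simp at this
        omega
      · rfl
  · rw [Matrix.blockDiagonal'_apply_ne _ _ _ hij]
    split_ifs with ha
    · rw [Pi.single_eq_of_ne]
      exact fun heq => hij (congrArg Sigma.fst heq)
    · rfl

lemma blockDiagonal_jordanBlock_pow_single (l : ι → ℕ) (j : ι) (k : ℕ) (a : Fin (l j)) :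
    (Matrix.toLin' (Matrix.blockDiagonal' fun j => jordanBlock F (l j)) ^ k)
      (Pi.single (⟨j, a⟩ : Σ j, Fin (l j)) 1) =
    if k ≤ (a : ℕ) then Pi.single ⟨j, ⟨a - k, by omega⟩⟩ 1 else 0 := by
  induction k with
  | zero => simp
  | succ k ih =>
    rw [pow_succ', Module.End.mul_apply, ih]
    split_ifs with h1 h2 h2
    · rw [blockDiagonal_jordanBlock_single, if_pos (by simp; omega)]
      rfl
    · rw [blockDiagonal_jordanBlock_single, if_neg (by simp; omega)]
    · omega
    · simp

lemma hasJordanType_blockDiagonal_jordanBlock {ι : Type} [Fintype ι] [DecidableEq ι] (l : ι → ℕ) :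
    HasJordanType (Matrix.toLin' (Matrix.blockDiagonal' fun j => jordanBlock F (l j)))
      (Finset.univ.val.map l) := by
  -- `jordanBlock` lowers the index of a unit vector, so the chain starts at the last one; hence the
  -- reversal `Fin.revPerm` below. An empty block gets the harmless generator 0.
  let g : ι → (Σ j, Fin (l j)) → F := fun j =>
    if h : 0 < l j then Pi.single ⟨j, ⟨l j - 1, Nat.sub_lt h one_pos⟩⟩ 1 else 0
  refine ⟨ι, inferInstance, l, g, IsJordanSystem.of_basis
    ((Pi.basisFun F (Σ j, Fin (l j))).reindex (Equiv.sigmaCongrRight fun j => Fin.revPerm))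
    (fun j => ?_) ?_, rfl⟩
  · by_cases h : 0 < l j
    · simp only [g, dif_pos h]
      rw [blockDiagonal_jordanBlock_pow_single, if_neg (by simp; omega)]
    · simp only [g, dif_neg h, map_zero]
  · rintro ⟨j, k⟩
    have h : 0 < l j := by have := k.2; omega
    simp only [g, dif_pos h]
    rw [blockDiagonal_jordanBlock_pow_single, if_pos (by simp; omega), Basis.reindex_apply,
      Pi.basisFun_apply]
    congr 1
    change (⟨j, Fin.rev k⟩ : Σ j, Fin (l j)) = _
    congr 1
    ext
    simp [Fin.val_rev]
    omega

end Model

/-- The homomorphism for the operators `T` and `J` attached to a linear functional. -/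
lemma exists_intertwine_of_functional (T : End F V) (J : End F W) {k : ℕ} (hT : T ^ k = 0) {g : W}
    (hg : (J ^ k) g = 0) (φ : V →ₗ[F] F) :
    ∃ f : V →ₗ[F] W, (∀ x, f (T x) = J (f x)) ∧
      ∀ x, f x = ∑ e ∈ Finset.range k, φ ((T ^ e) x) • (J ^ (k - 1 - e)) g := by
  let f : V →ₗ[F] W := ∑ e ∈ Finset.range k,
    (LinearMap.toSpanSingleton F W ((J ^ (k - 1 - e)) g)) ∘ₗ φ ∘ₗ (T ^ e)
  have hf : ∀ x, f x = ∑ e ∈ Finset.range k, φ ((T ^ e) x) • (J ^ (k - 1 - e)) g := by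
    intro x
    simp [f, LinearMap.sum_apply]
  refine ⟨f, fun x => ?_, hf⟩
  rw [hf, hf, map_sum]
  rcases k with _ | k
  · simp
  -- The two sums agree after a shift of `e` by one; the unmatched end terms vanish because $T^k=0$
  -- and $J^kg=0$.
  rw [Finset.sum_range_succ, Finset.sum_range_succ']
  have h1 : (T ^ k) (T x) = 0 := by
    rw [← Module.End.mul_apply, ← pow_succ, hT]; rfl
  have h2 : J ((J ^ (k + 1 - 1 - 0)) g) = 0 := by
    rw [← Module.End.mul_apply, ← pow_succ']; simpa using hg
  rw [h1, map_smul J (φ ((T ^ 0) x)), h2]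
  simp only [map_zero, zero_smul, smul_zero, add_zero, map_smul]
  refine Finset.sum_congr rfl fun e he => ?_
  have he' := Finset.mem_range.1 he
  rw [← Module.End.mul_apply, ← pow_succ, ← Module.End.mul_apply, ← pow_succ']
  congr 3
  omega

/-- A chain of maximal length splits off. A functional that is 1 on the end of the chain of `v`
defines an intertwiner `Φ` back to the single block, unipotent on that chain, so `ker Φ` is an
invariant complement of smaller dimension. -/
theorem exists_hasJordanType [FiniteDimensional F V] {T : End F V} (hT : IsNilpotent T) :
    ∃ s, HasJordanType T s ∧ ∀ p ∈ s, 0 < p := by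
  induction hn : finrank F V using Nat.strong_induction_on generalizing V with
  | _ n ih =>
  by_cases hV : Subsingleton V
  · refine ⟨0, ⟨Empty, inferInstance, fun _ => 0, fun _ => 0, ⟨by simp, ?_, ?_⟩, by simp⟩, by simp⟩
    · exact linearIndependent_empty_type
    · intro x _
      rw [Subsingleton.elim x 0]
      exact zero_mem _
  · rw [not_subsingleton_iff_nontrivial] at hV
    obtain ⟨k, hk⟩ : ∃ k, nilpotencyClass T = k + 1 :=
      Nat.exists_eq_succ_of_ne_zero (pos_nilpotencyClass_iff.2 hT).ne'
    obtain ⟨hk1, hk0⟩ := nilpotencyClass_eq_succ_iff.1 hk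
    obtain ⟨v₀, hv₀⟩ : ∃ v, (T ^ k) v ≠ 0 := by
      by_contra! h
      exact hk0 (LinearMap.ext h)
    obtain ⟨φ, hφ⟩ : ∃ φ : V →ₗ[F] F, φ ((T ^ k) v₀) ≠ 0 := by
      by_contra! h
      exact hv₀ ((Module.forall_dual_apply_eq_zero_iff F _).1 h)
    obtain ⟨v, hv⟩ : ∃ v, φ ((T ^ k) v) = 1 :=
      ⟨(φ ((T ^ k) v₀))⁻¹ • v₀, by rw [map_smul, map_smul, smul_eq_mul, inv_mul_cancel₀ hφ]⟩
    have hmodel := hasJordanType_blockDiagonal_jordanBlock (F := F) (fun _ : Unit => k + 1)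
    set J := Matrix.toLin' (Matrix.blockDiagonal' fun _ : Unit => jordanBlock F (k + 1)) with hJ
    obtain ⟨g, hg⟩ := hmodel.exists_system rfl
    obtain ⟨L, hL, hLg⟩ := hg.exists_lift T (fun _ => v) (fun _ => by simp [hk1])
    obtain ⟨Φ, hΦ, hΦv⟩ := exists_intertwine_of_functional T J hk1 (hg.pow_eq_zero ()) φ
    -- In `Φ (L g)` the term `e = k` is the generator itself; the rest is a polynomial in `J`
    -- without constant term, hence nilpotent.
    let N := ∑ e ∈ Finset.range k, φ ((T ^ e) v) • J ^ (k - e)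
    have hJnil : IsNilpotent J := hmodel.isNilpotent
    have hcomm : ∀ e, Commute (φ ((T ^ e) v) • J ^ (k - e)) J := fun e =>
      ((Commute.refl J).pow_left _).smul_left _
    have hN : IsNilpotent N := by
      refine Commute.isNilpotent_sum (fun e he => ?_) fun i j _ _ => ?_
      · have : k - e ≠ 0 := by have := Finset.mem_range.1 he; omega
        exact (hJnil.pow_of_pos this).smul _
      · exact ((hcomm i).pow_right _).smul_right _
    have hNJ : Commute N J := Commute.sum_left _ _ _ fun e _ => hcomm e
    have hθ : Φ ∘ₗ L = ((1 + N : End F _) : (_ →ₗ[F] _)) := by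
      refine hg.map_ext_of_intertwine (T' := J) (fun x => by simp [hL, hΦ]) (fun x => ?_)
        fun _ => ?_
      · have := LinearMap.congr_fun hNJ.eq x
        simp only [Module.End.mul_apply] at this
        simp [this]
      · rw [LinearMap.comp_apply, hLg, hΦv, Finset.sum_range_succ, hv]
        simp only [N, LinearMap.add_apply, LinearMap.sum_apply, LinearMap.smul_apply]
        simp [add_comm]
    obtain ⟨u, hu⟩ : IsUnit (1 + N : End F _) := hN.isUnit_one_add
    have huinv : ∀ x, (↑u⁻¹ : End F _) (Φ (L x)) = x := by
      intro x
      have : Φ (L x) = (u : End F _) x := by rw [hu, ← hθ]; rfl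
      rw [this, ← Module.End.mul_apply, Units.inv_mul]; rfl
    have huinv' : ∀ x, Φ (L ((↑u⁻¹ : End F _) x)) = x := by
      intro x
      have : Φ (L ((↑u⁻¹ : End F _) x)) = (u : End F _) ((↑u⁻¹ : End F _) x) := by
        rw [hu, ← hθ]; rfl
      rw [this, ← Module.End.mul_apply, Units.mul_inv]; rfl
    have hinv : ∀ x ∈ LinearMap.ker Φ, T x ∈ LinearMap.ker Φ := by
      intro x hx
      rw [LinearMap.mem_ker] at hx ⊢
      rw [hΦ, hx, map_zero]
    let S : End F (LinearMap.ker Φ) := T.restrict hinv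
    let E : ((Σ _ : Unit, Fin (k + 1)) → F) × LinearMap.ker Φ →ₗ[F] V :=
      L.coprod (LinearMap.ker Φ).subtype
    have hE : Function.Bijective E := by
      constructor
      · rw [injective_iff_map_eq_zero]
        rintro ⟨y, w⟩ hyw
        have h0 : L y + w = 0 := by simpa [E] using hyw
        have hy : y = 0 := by
          have h1 := congrArg Φ h0
          rw [map_add, LinearMap.mem_ker.1 w.2, add_zero, map_zero] at h1
          rw [← huinv y, h1, map_zero]
        subst hy
        simpa using h0
      · intro x
        refine ⟨((↑u⁻¹ : End F _) (Φ x), ⟨x - L ((↑u⁻¹ : End F _) (Φ x)), ?_⟩), ?_⟩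
        · rw [LinearMap.mem_ker, map_sub, huinv', sub_self]
        · simp [E]
    let E' := LinearEquiv.ofBijective E hE
    have hE' : ∀ x, E' (J.prodMap S x) = T (E' x) := by
      rintro ⟨y, w⟩
      simp [E', E, hL, S]
    have hS : IsNilpotent S := by
      refine ⟨k + 1, ?_⟩
      have h2 := Module.End.pow_restrict (k + 1) hinv
      ext x
      rw [h2]
      simp [hk1]
    have hdim : finrank F (LinearMap.ker Φ) < n := by
      rw [← hn, ← E'.finrank_eq, Module.finrank_prod]
      simp
    obtain ⟨s, hs, hpos⟩ := ih _ hdim hS rfl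
    refine ⟨_, (hmodel.prod hs).of_equiv E' hE', ?_⟩
    intro p hp
    rw [Multiset.mem_add] at hp
    rcases hp with hp | hp
    · simp at hp
      omega
    · exact hpos p hp

lemma map_part {n : ℕ} (lam : n.Partition) :
    Finset.univ.val.map (fun j : Fin (Multiset.card lam.parts) => part lam (j + 1)) = lam.parts := by
  have hlen : (lam.parts.sort (· ≥ ·)).length = Multiset.card lam.parts := by simp
  have : (fun j : Fin (Multiset.card lam.parts) => part lam (j + 1)) =
      fun j => (lam.parts.sort (· ≥ ·)).get (Fin.cast hlen.symm j) := by
    funext j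
    simp [part]
  rw [this]
  conv_rhs => rw [← Multiset.sort_eq lam.parts (· ≥ ·), ← List.ofFn_get (lam.parts.sort (· ≥ ·))]
  rw [List.ofFn_congr hlen, Fin.univ_val_map]

lemma hasJordanType_jordanMatrix {n : ℕ} (lam : n.Partition) :
    HasJordanType (Matrix.toLin' (jordanMatrix F lam)) lam.parts := by
  have := hasJordanType_blockDiagonal_jordanBlock (F := F)
    (fun j : Fin (Multiset.card lam.parts) => part lam (j + 1))
  rwa [map_part] at this

theorem mem_nilpotentOrbit_iff {n : ℕ} (lam : n.Partition) (A : Matrix (Fin n) (Fin n) F) :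
    A ∈ nilpotentOrbit F lam ↔ HasJordanType (Matrix.toLin' A) lam.parts := by
  have hmodel := hasJordanType_jordanMatrix (F := F) lam
  have hre : ∀ (e : (Σ j : Fin lam.parts.card, Fin (part lam (j + 1))) ≃ Fin n)
      (x : (Σ j : Fin lam.parts.card, Fin (part lam (j + 1))) → F),
      (Matrix.reindex e e (jordanMatrix F lam)).mulVec (x ∘ e.symm) =
        (jordanMatrix F lam).mulVec x ∘ e.symm := by
    intro e x
    funext i
    simp only [Matrix.mulVec, dotProduct, Matrix.reindex_apply, Matrix.submatrix_apply,
      Function.comp_apply]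
    exact e.symm.sum_comp fun b => jordanMatrix F lam (e.symm i) b * x b
  constructor
  · rintro ⟨e, P, rfl⟩
    let E : ((Σ j : Fin lam.parts.card, Fin (part lam (j + 1))) → F) ≃ₗ[F] (Fin n → F) :=
      (LinearEquiv.funCongrLeft F F e.symm).trans (Matrix.GeneralLinearGroup.toLin P).toLinearEquiv
    have hE : ∀ x, E x = (P : Matrix (Fin n) (Fin n) F).mulVec (x ∘ e.symm) := fun x => rfl
    refine hmodel.of_equiv E fun x => ?_
    rw [hE, hE, Matrix.toLin'_apply, Matrix.toLin'_apply, Matrix.mulVec_mulVec, mul_assoc,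
      Units.inv_mul, mul_one, ← Matrix.mulVec_mulVec, hre]
  · intro h
    obtain ⟨E, hE⟩ := hmodel.exists_equiv h
    have hcard : Fintype.card (Σ j : Fin lam.parts.card, Fin (part lam (j + 1))) = n := by
      have h1 := E.finrank_eq
      simpa using h1
    let e := Fintype.equivFinOfCardEq hcard
    let Q : (Fin n → F) ≃ₗ[F] (Fin n → F) := (LinearEquiv.funCongrLeft F F e).trans E
    let P : GL (Fin n) F := ⟨LinearMap.toMatrix' (Q : (Fin n → F) →ₗ[F] _),
      LinearMap.toMatrix' (Q.symm : (Fin n → F) →ₗ[F] _), by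
        rw [← LinearMap.toMatrix'_comp]; simp, by rw [← LinearMap.toMatrix'_comp]; simp⟩
    refine ⟨e, P, ?_⟩
    have key : A * (P : Matrix (Fin n) (Fin n) F) =
        (P : Matrix (Fin n) (Fin n) F) * Matrix.reindex e e (jordanMatrix F lam) := by
      apply Matrix.toLin'.injective
      refine LinearMap.ext fun x => ?_
      obtain ⟨y, rfl⟩ : ∃ y : (Σ j : Fin lam.parts.card, Fin (part lam (j + 1))) → F,
        x = y ∘ e.symm := ⟨x ∘ e, by funext i; simp⟩
      have hP : ∀ z, (P : Matrix (Fin n) (Fin n) F).mulVec z = Q z := fun z => by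
        change (LinearMap.toMatrix' (Q : (Fin n → F) →ₗ[F] _)).mulVec z = Q z
        rw [LinearMap.toMatrix'_mulVec]; rfl
      have hQ : ∀ z : (Σ j : Fin lam.parts.card, Fin (part lam (j + 1))) → F,
          Q (z ∘ e.symm) = E z := by
        intro z
        change E ((z ∘ e.symm) ∘ e) = E z
        congr 1
        funext i; simp
      rw [Matrix.toLin'_apply, Matrix.toLin'_apply, ← Matrix.mulVec_mulVec, ← Matrix.mulVec_mulVec,
        hre, hP, hP, hQ, hQ, ← Matrix.toLin'_apply, ← Matrix.toLin'_apply, hE]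
    rw [← key, mul_assoc, Units.mul_inv, mul_one]

end JordanExistence

/-! ### A linear space of nilpotents meeting every nilpotent conjugacy class -/

section Conjugation

/-- Each factor moves the support at least one further diagonal down. -/
lemma pow_apply_eq_zero_of_strictlyLower {F : Type*} [Field F] {d : ℕ}
    {X : Matrix (Fin d) (Fin d) F} (hX : ∀ a b, a ≤ b → X a b = 0) (k : ℕ) (a b : Fin d)
    (hab : (a : ℕ) < b + k) : (X ^ k) a b = 0 := by
  induction k generalizing a b with
  | zero =>
    rw [pow_zero, Matrix.one_apply_ne]
    rintro rfl
    omega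
  | succ k ih =>
    rw [pow_succ, Matrix.mul_apply]
    refine Finset.sum_eq_zero fun c _ => ?_
    rcases le_or_gt c b with hcb | hcb
    · rw [hX c b hcb, mul_zero]
    · rw [ih a c (by have := Fin.lt_def.1 hcb; omega), zero_mul]

/-- List a Jordan basis chain by chain: the operator sends each basis vector to a later one or to 0.
-/
lemma exists_conj_strictlyLower {F : Type*} [Field F] {d : ℕ} {N : Matrix (Fin d) (Fin d) F}
    (hN : IsNilpotent N) : ∃ P : (Matrix (Fin d) (Fin d) F)ˣ, ∀ a b, a ≤ b →
      ((P : Matrix (Fin d) (Fin d) F) * N * (↑P⁻¹ : Matrix (Fin d) (Fin d) F)) a b = 0 := by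
  have hT : IsNilpotent (Matrix.toLin' N) := hN.map Matrix.toLinAlgEquiv'
  obtain ⟨s, ⟨ι, _, l, g, hg, rfl⟩, -⟩ := exists_hasJordanType hT
  have hg' := hg.reindex (Fintype.equivFin ι).symm
  set l' := fun j => l ((Fintype.equivFin ι).symm j)
  have hsum : ∑ j, l' j = d := by
    rw [← hg'.finrank_eq]; simp
  let e : (Σ j, Fin (l' j)) ≃ Fin d := finSigmaFinEquiv.trans (finCongr hsum)
  have he : ∀ j (k k' : Fin (l' j)), k < k' → e ⟨j, k⟩ < e ⟨j, k'⟩ := by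
    intro j k k' hk
    rw [Fin.lt_def]
    simp only [e, Equiv.trans_apply, finCongr_apply, Fin.val_cast, finSigmaFinEquiv_apply]
    have := Fin.lt_def.1 hk
    omega
  let b := hg'.basis.reindex e
  let Q : (Fin d → F) ≃ₗ[F] (Fin d → F) := b.equivFun
  let P : (Matrix (Fin d) (Fin d) F)ˣ := ⟨LinearMap.toMatrix' (Q : (Fin d → F) →ₗ[F] _),
      LinearMap.toMatrix' (Q.symm : (Fin d → F) →ₗ[F] _), by
        rw [← LinearMap.toMatrix'_comp]; simp, by rw [← LinearMap.toMatrix'_comp]; simp⟩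
  refine ⟨P, fun a c hac => ?_⟩
  have h1 : (P : Matrix (Fin d) (Fin d) F) * N * (↑P⁻¹ : Matrix (Fin d) (Fin d) F) =
      LinearMap.toMatrix' ((Q : (Fin d → F) →ₗ[F] _) ∘ₗ Matrix.toLin' N ∘ₗ
        (Q.symm : (Fin d → F) →ₗ[F] _)) := by
    rw [LinearMap.toMatrix'_comp, LinearMap.toMatrix'_comp, LinearMap.toMatrix'_toLin', mul_assoc]
    rfl
  rw [h1, LinearMap.toMatrix'_apply]
  obtain ⟨⟨j, k⟩, rfl⟩ := e.surjective c
  have h2 : Q.symm (Pi.single (e ⟨j, k⟩) 1) = b (e ⟨j, k⟩) := by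
    simp [Q, b.equivFun_symm_apply, Pi.single_apply]
  have h3 : ∀ v, ((Q : (Fin d → F) →ₗ[F] _) ∘ₗ Matrix.toLin' N ∘ₗ
        (Q.symm : (Fin d → F) →ₗ[F] _)) v = Q (Matrix.toLin' N (Q.symm v)) := fun v => rfl
  rw [h3]
  simp only [h2]
  rw [show b (e ⟨j, k⟩) = hg'.basis ⟨j, k⟩ by simp [b], hg'.basis_apply, ← Module.End.mul_apply,
    ← pow_succ']
  by_cases hk : (k : ℕ) + 1 < l' j
  · have h5 := hg'.basis_apply j ⟨k + 1, hk⟩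
    simp only at h5
    rw [← h5, show hg'.basis ⟨j, ⟨k + 1, hk⟩⟩ = b (e ⟨j, ⟨k + 1, hk⟩⟩) by simp [b]]
    have h6 := he j k ⟨k + 1, hk⟩ (Fin.lt_def.2 (by simp))
    simp only [Q, Basis.equivFun_self]
    rw [if_neg]
    rintro rfl
    exact absurd hac (not_le.2 h6)
  · rw [hg'.pow_eq_zero_of_le (by omega), map_zero]; rfl

/-- In a finite-dimensional algebra over an algebraically closed field there is a linear space of
nilpotent elements that meets every conjugacy class of nilpotent elements. -/
theorem exists_submodule_isNilpotent (F : Type*) [Field F] [IsAlgClosed F] (R : Type*) [Ring R]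
    [Algebra F R] [FiniteDimensional F R] :
    ∃ S : Submodule F R, (∀ x ∈ S, IsNilpotent x) ∧
      ∀ x : R, IsNilpotent x → ∃ u : Rˣ, (u : R) * x * (↑u⁻¹ : R) ∈ S := by
  have : IsArtinianRing R := IsArtinianRing.of_finite F R
  let J := Ring.jacobson R
  have hJ : ∃ k : ℕ, ∀ x ∈ J, x ^ k = 0 := by
    obtain ⟨k, hk⟩ := IsSemiprimaryRing.isNilpotent (R := R)
    refine ⟨k, fun x hx => ?_⟩
    have := Ideal.pow_mem_pow hx k
    rw [hk] at this
    simpa using this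
  obtain ⟨k, hk⟩ := hJ
  let π : R →ₐ[F] R ⧸ J := Ideal.Quotient.mkₐ F J
  have hπs : Function.Surjective π := Ideal.Quotient.mkₐ_surjective F J
  have hπ : ∀ x, π x = 0 → x ^ k = 0 := fun x hx => hk x (Ideal.Quotient.eq_zero_iff_mem.1 hx)
  have : FiniteDimensional F (R ⧸ J) := Module.Finite.of_surjective π.toLinearMap hπs
  obtain ⟨m, d, -, ⟨E⟩⟩ := IsSemisimpleRing.exists_algEquiv_pi_matrix_of_isAlgClosed F (R ⧸ J)
  have hnil : ∀ x, IsNilpotent (π x) → IsNilpotent x := by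
    rintro x ⟨r, hr⟩
    refine ⟨r * k, ?_⟩
    rw [pow_mul]
    exact hπ _ (by rw [map_pow, hr])
  -- Modulo its nilpotent radical, `R` is a product of matrix algebras; `S` is the preimage of the
  -- strictly lower triangular tuples.
  let S : Submodule F R :=
    { carrier := {x | ∀ i a b, a ≤ b → E (π x) i a b = 0}
      add_mem' := by
        intro x y hx hy i a b hab
        simp [hx i a b hab, hy i a b hab]
      zero_mem' := by
        intro i a b _
        simp
      smul_mem' := by
        intro c x hx i a b hab
        simp [hx i a b hab] }
  refine ⟨S, fun x hx => hnil x ?_, fun x hx => ?_⟩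
  · suffices h : IsNilpotent (E (π x)) by
      obtain ⟨r, hr⟩ := h
      exact ⟨r, E.injective (by rw [map_pow, hr, map_zero])⟩
    have h : ∀ i, (E (π x) i) ^ (∑ i, d i) = 0 := by
      intro i
      have h1 : (E (π x) i) ^ d i = 0 := Matrix.ext fun a b =>
        pow_apply_eq_zero_of_strictlyLower (hx i) (d i) a b (by omega)
      exact pow_eq_zero_of_le (Finset.single_le_sum (fun _ _ => Nat.zero_le _)
        (Finset.mem_univ i)) h1
    exact ⟨∑ i, d i, funext h⟩
  · have hx' : ∀ i, IsNilpotent (E (π x) i) := fun i =>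
      ((hx.map π).map E).map (Pi.evalRingHom (fun i => Matrix (Fin (d i)) (Fin (d i)) F) i)
    choose P hP using fun i => exists_conj_strictlyLower (hx' i)
    -- The conjugating tuple and its inverse are lifted separately; the lifts are inverse only
    -- modulo the radical, which suffices for `p` to be a unit.
    obtain ⟨p, hp⟩ : ∃ p, E (π p) = fun i => (P i : Matrix (Fin (d i)) (Fin (d i)) F) := by
      obtain ⟨p, hp⟩ := hπs (E.symm fun i => (P i : Matrix (Fin (d i)) (Fin (d i)) F))
      exact ⟨p, by rw [hp]; simp⟩
    obtain ⟨q, hq⟩ : ∃ q, E (π q) = fun i => (↑(P i)⁻¹ : Matrix (Fin (d i)) (Fin (d i)) F) := by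
      obtain ⟨q, hq⟩ := hπs (E.symm fun i => (↑(P i)⁻¹ : Matrix (Fin (d i)) (Fin (d i)) F))
      exact ⟨q, by rw [hq]; simp⟩
    have hunit : ∀ y, E (π y) = 1 → IsUnit y := by
      intro y hy
      have h1 : π (y - 1) = 0 := by
        apply E.injective
        rw [map_sub, map_sub, hy, map_one, map_one, sub_self, map_zero]
      have h2 : IsNilpotent (y - 1) := ⟨k, hπ _ h1⟩
      simpa using h2.isUnit_one_add
    have hpq : IsUnit (p * q) := hunit _ (by
      rw [map_mul, map_mul, hp, hq]; funext i; simp)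
    have hqp : IsUnit (q * p) := hunit _ (by
      rw [map_mul, map_mul, hp, hq]; funext i; simp)
    have hpu : IsUnit p := by
      obtain ⟨v, hv⟩ := hpq
      obtain ⟨w, hw⟩ := hqp
      have h1 : p * (q * (↑v⁻¹ : R)) = 1 := by rw [← mul_assoc, ← hv, Units.mul_inv]
      have h2 : ((↑w⁻¹ : R) * q) * p = 1 := by rw [mul_assoc, ← hw, Units.inv_mul]
      have h3 : (↑w⁻¹ : R) * q = q * (↑v⁻¹ : R) := left_inv_eq_right_inv h2 h1
      exact ⟨⟨p, q * (↑v⁻¹ : R), h1, by rw [← h3, h2]⟩, rfl⟩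
    obtain ⟨u, rfl⟩ := hpu
    refine ⟨u, fun i a b hab => ?_⟩
    have huinv : ∀ i, E (π (↑u⁻¹ : R)) i = (↑(P i)⁻¹ : Matrix (Fin (d i)) (Fin (d i)) F) := by
      intro i
      have h1 : E (π (u : R)) i * E (π (↑u⁻¹ : R)) i = 1 := by
        rw [← Pi.mul_apply, ← map_mul, ← map_mul, Units.mul_inv, map_one, map_one]; rfl
      rw [hp] at h1
      exact (Units.inv_eq_of_mul_eq_one_right h1).symm
    have := hP i a b hab
    rw [map_mul, map_mul, map_mul, map_mul, Pi.mul_apply, Pi.mul_apply, huinv, hp]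
    exact this

end Conjugation

/-! ### Constraints on nilpotent operators commuting with a given one -/

section UpperBounds

variable {F : Type*} [Field F] {V : Type*} [AddCommGroup V] [Module F V] {ι : Type*}

lemma pow_finrank_eq_zero_of_isNilpotent [FiniteDimensional F V] {A : End F V}
    (hA : IsNilpotent A) : A ^ finrank F V = 0 := by
  have h := LinearMap.aeval_self_charpoly A
  rw [hA.charpoly_eq_X_pow_finrank] at h
  simpa using h

lemma pow_apply_eq_zero_of_finrank_le [FiniteDimensional F V] {A : End F V}
    (hA : IsNilpotent A) {S : Submodule F V} (hS : ∀ x ∈ S, A x ∈ S) {m : ℕ}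
    (hm : finrank F S ≤ m) {x : V} (hx : x ∈ S) : (A ^ m) x = 0 := by
  have hpow : ∀ k (y : S), (((A.restrict hS) ^ k) y : V) = (A ^ k) y := by
    intro k y
    rw [Module.End.pow_restrict]
    rfl
  have hnil : IsNilpotent (A.restrict hS) := by
    obtain ⟨k, hk⟩ := hA
    refine ⟨k, LinearMap.ext fun y => Subtype.ext ?_⟩
    rw [hpow, hk]
    rfl
  have h0 := pow_eq_zero_of_le hm (pow_finrank_eq_zero_of_isNilpotent hnil)
  rw [← hpow m ⟨x, hx⟩, h0]
  rfl

/-- The image of `W` in `V ⧸ Z` is invariant of dimension at most the number of the `w i`, and a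
nilpotent operator dies at the power given by the dimension. -/
lemma pow_apply_mem_of_le_span_sup [FiniteDimensional F V] [Fintype ι] {A : End F V}
    (hA : IsNilpotent A) {W Z : Submodule F V} (hW : ∀ x ∈ W, A x ∈ W) (hZ : ∀ x ∈ Z, A x ∈ Z)
    (w : ι → V) (hw : W ≤ Submodule.span F (Set.range w) ⊔ Z) {x : V} (hx : x ∈ W) :
    (A ^ Fintype.card ι) x ∈ Z := by
  let B : End F (V ⧸ Z) := Z.mapQ Z A hZ
  have hB : ∀ k y, (B ^ k) (Z.mkQ y) = Z.mkQ ((A ^ k) y) := fun k y =>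
    (IsJordanSystem.intertwine_pow (L := Z.mkQ) (T := A) (T' := B) (fun _ => rfl) k y).symm
  have hBn : IsNilpotent B := by
    obtain ⟨k, hk⟩ := hA
    refine ⟨k, LinearMap.ext fun y => ?_⟩
    obtain ⟨y, rfl⟩ := Z.mkQ_surjective y
    rw [hB, hk]
    simp
  have hle : W.map Z.mkQ ≤ Submodule.span F (Set.range fun i => Z.mkQ (w i)) := by
    refine (Submodule.map_mono hw).trans ?_
    rw [Submodule.map_sup, Submodule.map_span, ← Set.range_comp]
    refine sup_le le_rfl ?_
    rw [Submodule.mkQ_map_self]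
    exact bot_le
  have hfin : finrank F (W.map Z.mkQ) ≤ Fintype.card ι :=
    (Submodule.finrank_mono hle).trans (finrank_range_le_card _)
  have hinv : ∀ y ∈ W.map Z.mkQ, B y ∈ W.map Z.mkQ := by
    rintro _ ⟨y, hy, rfl⟩
    exact ⟨A y, hW y hy, rfl⟩
  have h0 := pow_apply_eq_zero_of_finrank_le hBn hinv hfin (Submodule.mem_map_of_mem hx)
  rw [hB] at h0
  exact (Submodule.Quotient.mk_eq_zero Z).1 h0

lemma finrank_ker_pow_le [FiniteDimensional F V] (A : End F V) (k : ℕ) :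
    finrank F (LinearMap.ker (A ^ k)) ≤ k * finrank F (LinearMap.ker A) := by
  induction k with
  | zero =>
    rw [pow_zero, Module.End.one_eq_id, LinearMap.ker_id]
    simp
  | succ k ih =>
    let f : LinearMap.ker (A ^ (k + 1)) →ₗ[F] V := A.domRestrict _
    have h1 := LinearMap.finrank_range_add_finrank_ker f
    have h2 : LinearMap.range f ≤ LinearMap.ker (A ^ k) := by
      rintro _ ⟨x, rfl⟩
      rw [LinearMap.mem_ker]
      change (A ^ k) (A x) = 0
      rw [← Module.End.mul_apply, ← pow_succ]
      exact x.2
    have h3 : finrank F (LinearMap.ker f) ≤ finrank F (LinearMap.ker A) := by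
      refine LinearMap.finrank_le_finrank_of_injective
        (f := ((LinearMap.ker (A ^ (k + 1))).subtype ∘ₗ (LinearMap.ker f).subtype).codRestrict
          (LinearMap.ker A) fun x => x.2) ?_
      intro x y hxy
      exact Subtype.ext (Subtype.ext (congrArg (fun z : LinearMap.ker A => (z : V)) hxy))
    have h4 := Submodule.finrank_mono h2
    rw [add_mul, one_mul]
    omega

/-- An invariant subspace of dimension $d$ lies in $\ker A^d$, which has dimension at most $d$ here.
-/
lemma eq_ker_pow_of_finrank_ker_le_one [FiniteDimensional F V] {A : End F V}
    (hA : IsNilpotent A) (hker : finrank F (LinearMap.ker A) ≤ 1) {S : Submodule F V}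
    (hS : ∀ x ∈ S, A x ∈ S) : S = LinearMap.ker (A ^ finrank F S) := by
  refine Submodule.eq_of_le_of_finrank_le (fun x hx => ?_) ?_
  · exact pow_apply_eq_zero_of_finrank_le hA hS le_rfl hx
  · exact (finrank_ker_pow_le A _).trans (mul_le_of_le_one_right (Nat.zero_le _) hker)

/-- The subspaces invariant under a nilpotent operator with one Jordan block form a chain. -/
lemma le_or_le_of_finrank_ker_le_one [FiniteDimensional F V] {A : End F V}
    (hA : IsNilpotent A) (hker : finrank F (LinearMap.ker A) ≤ 1) {S S' : Submodule F V}
    (hS : ∀ x ∈ S, A x ∈ S) (hS' : ∀ x ∈ S', A x ∈ S') : S ≤ S' ∨ S' ≤ S := by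
  have key : ∀ {a b : ℕ}, a ≤ b → LinearMap.ker (A ^ a) ≤ LinearMap.ker (A ^ b) := by
    intro a b hab x hx
    obtain ⟨c, rfl⟩ := Nat.exists_eq_add_of_le' hab
    rw [LinearMap.mem_ker] at hx ⊢
    rw [pow_add, Module.End.mul_apply, hx, map_zero]
  rw [eq_ker_pow_of_finrank_ker_le_one hA hker hS, eq_ker_pow_of_finrank_ker_le_one hA hker hS']
  exact (le_total _ _).imp key key

namespace IsJordanSystem

variable {T : End F V} {l : ι → ℕ} {g : ι → V}

lemma coord_pow (h : IsJordanSystem T l g) (r : ℕ) (v : V) (j : ι) (k : Fin (l j)) :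
    h.basis.coord ⟨j, k⟩ ((T ^ r) v) =
      if r ≤ (k : ℕ) then h.basis.coord ⟨j, ⟨k - r, by omega⟩⟩ v else 0 := by
  classical
  have hcoord : ∀ (i : ι) (m : ℕ) (k' : Fin (l j)), h.basis.coord ⟨j, k'⟩ ((T ^ m) (g i)) =
      if i = j ∧ m = k' then 1 else 0 := by
    intro i m k'
    rcases lt_or_ge m (l i) with hm | hm
    · have h1 := h.basis_apply i ⟨m, hm⟩
      simp only at h1
      rw [← h1, Basis.coord_apply, Basis.repr_self, Finsupp.single_apply]
      congr 1
      rw [eq_iff_iff]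
      constructor
      · intro heq
        obtain ⟨rfl, h2⟩ := Sigma.mk.inj heq
        exact ⟨rfl, congrArg Fin.val (eq_of_heq h2)⟩
      · rintro ⟨rfl, h2⟩
        congr 1
        exact Fin.ext h2
    · rw [h.pow_eq_zero_of_le hm, map_zero, if_neg]
      rintro ⟨rfl, h2⟩
      omega
  suffices H : h.basis.coord ⟨j, k⟩ ∘ₗ (T ^ r) =
      if r ≤ (k : ℕ) then h.basis.coord ⟨j, ⟨k - r, by omega⟩⟩ else 0 by
    have := LinearMap.congr_fun H v
    rw [LinearMap.comp_apply] at this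
    rw [this]
    split_ifs <;> rfl
  refine h.map_ext fun i m _ => ?_
  rw [LinearMap.comp_apply, ← Module.End.mul_apply, ← pow_add, hcoord]
  split_ifs with h1 h2 h2
  · rw [hcoord, if_pos ⟨h1.1, by simp; omega⟩]
  · omega
  · rw [hcoord, if_neg]
    rintro ⟨h3, h4⟩
    simp only at h4
    exact h1 ⟨h3, by omega⟩
  · rfl

/-- The successive quotients of the subspaces `range (T ^ x) ⊓ ker (T ^ y)` are spanned by the
chains of length `x + y`. -/
lemma range_inf_ker_le [Fintype ι] (h : IsJordanSystem T l g) (x y : ℕ) :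
    LinearMap.range (T ^ x) ⊓ LinearMap.ker (T ^ (y + 1)) ≤
      Submodule.span F (Set.range fun j : {j // l j = x + (y + 1)} => (T ^ x) (g j)) ⊔
        ((LinearMap.range (T ^ (x + 1)) ⊓ LinearMap.ker (T ^ (y + 1))) ⊔
          (LinearMap.range (T ^ x) ⊓ LinearMap.ker (T ^ y))) := by
  rintro _ ⟨⟨u, rfl⟩, hu⟩
  have hu1 : (T ^ (y + 1 + x)) u = 0 := by rw [pow_add]; exact hu
  have hu' : (T ^ x) u = ∑ i, h.basis.repr u i • (T ^ x) (h.basis i) := by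
    have h0 := congrArg (T ^ x) (h.basis.sum_repr u)
    simp only [map_sum, map_smul] at h0
    exact h0.symm
  rw [hu']
  refine Submodule.sum_mem _ fun ⟨j, k⟩ _ => ?_
  rw [h.basis_apply, ← Module.End.mul_apply, ← pow_add]
  have hker : ∀ a b, l j ≤ b + a → (T ^ a) (g j) ∈ LinearMap.ker (T ^ b) := fun a b hab => by
    rw [LinearMap.mem_ker, ← Module.End.mul_apply, ← pow_add, h.pow_eq_zero_of_le hab]
  -- Basis vectors whose chain goes on too long have coefficient 0, as `T ^ (y + 1 + x)` kills `u`.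
  -- Among the others, `k > 0` gives the range of `T ^ (x + 1)`; for `k = 0` the vector is a listed
  -- generator or already lies in `ker (T ^ y)`.
  rcases lt_or_ge (x + k + (y + 1)) (l j) with h1 | h1
  · have h2 := h.coord_pow (y + 1 + x) u j ⟨x + k + (y + 1), h1⟩
    rw [hu1, map_zero, if_pos (by simp; omega), Basis.coord_apply] at h2
    have h3 : (⟨x + k + (y + 1) - (y + 1 + x), by omega⟩ : Fin (l j)) = k := Fin.ext (by simp; omega)
    rw [h3] at h2
    rw [← h2, zero_smul]
    exact zero_mem _
  refine Submodule.smul_mem _ _ ?_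
  rcases Nat.eq_zero_or_pos (k : ℕ) with hk | hk
  · rw [hk] at h1 ⊢
    rcases eq_or_ne (l j) (x + (y + 1)) with h2 | h2
    · exact Submodule.mem_sup_left (Submodule.subset_span ⟨⟨j, h2⟩, rfl⟩)
    · exact Submodule.mem_sup_right (Submodule.mem_sup_right
        ⟨⟨g j, rfl⟩, hker _ _ (by omega)⟩)
  · refine Submodule.mem_sup_right (Submodule.mem_sup_left
      ⟨⟨(T ^ (k - 1 : ℕ)) (g j), ?_⟩, hker _ _ (by omega)⟩)
    rw [← Module.End.mul_apply, ← pow_add]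
    congr 2
    omega

end IsJordanSystem

lemma mem_ker_pow_of_commute {A T : End F V} (hAT : Commute A T) (k : ℕ) {x : V}
    (hx : x ∈ LinearMap.ker (T ^ k)) : A x ∈ LinearMap.ker (T ^ k) := by
  have := LinearMap.congr_fun (hAT.pow_right k).eq x
  simp only [Module.End.mul_apply] at this
  rw [LinearMap.mem_ker] at hx ⊢
  rw [← this, hx, map_zero]

lemma mem_range_pow_of_commute {A T : End F V} (hAT : Commute A T) (k : ℕ) {x : V}
    (hx : x ∈ LinearMap.range (T ^ k)) : A x ∈ LinearMap.range (T ^ k) := by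
  obtain ⟨y, rfl⟩ := hx
  exact ⟨A y, (LinearMap.congr_fun (hAT.pow_right k).eq y).symm⟩

/-- The `A`-invariant subspaces form a chain, so `ker (T ^ l j)` and `range T` are comparable. But
`g j` lies only in the former and, if `l i ≥ l j + 2`, `T (g i)` only in the latter. -/
theorem HasJordanType.isAlmostRectangular {T : End F V} {s : Multiset ℕ} (h : HasJordanType T s)
    (hs : ∀ p ∈ s, 0 < p) {A : End F V} (hA : IsNilpotent A) (hAT : Commute A T)
    (hker : finrank F (LinearMap.ker A) ≤ 1) : IsAlmostRectangular s := by
  have := h.finite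
  obtain ⟨ι, _, l, g, hg, rfl⟩ := h
  suffices H : ∀ i j, 0 < l j → l i ≤ l j + 1 by
    intro a ha b hb
    obtain ⟨i, -, rfl⟩ := Multiset.mem_map.1 ha
    obtain ⟨j, -, rfl⟩ := Multiset.mem_map.1 hb
    exact H i j (hs _ hb)
  intro i j hj
  by_contra! hlt
  rcases le_or_le_of_finrank_ker_le_one hA hker (fun x => mem_ker_pow_of_commute hAT (l j))
    (fun x => mem_range_pow_of_commute hAT 1) with hle | hle
  · obtain ⟨x, hx⟩ := hle (show g j ∈ LinearMap.ker (T ^ l j) from hg.pow_eq_zero j)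
    have h1 := hg.coord_pow 1 x j ⟨0, hj⟩
    rw [hx, if_neg (by simp)] at h1
    have h2 := hg.basis_apply j ⟨0, hj⟩
    simp only [pow_zero, Module.End.one_apply] at h2
    rw [← h2] at h1
    simp at h1
  · have := hle ⟨g i, rfl⟩
    rw [LinearMap.mem_ker, ← Module.End.mul_apply, ← pow_add] at this
    exact hg.pow_ne_zero (by omega) this

/-- Put $d=x+y$. Applying $A$ $m_d$ times moves the subspace of $(x,y)$ into the sum of those of
$(x+1,y)$ and $(x,y-1)$, that is, to levels $d+1$ and $d-1$. A descent is thus a walk on levels,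
paying $m_d$ at each visit. The costliest walks go down to some level $q$, bounce between two
adjacent levels, and climb back; `ht` is the budget this requires. The inequality is shaped so that
it is inherited by both successors. -/
theorem pow_apply_eq_zero_of_mem_range_inf_ker [Fintype ι] [FiniteDimensional F V] {T A : End F V}
    {l : ι → ℕ} {g : ι → V} (h : IsJordanSystem T l g) (hA : IsNilpotent A) (hAT : Commute A T)
    (m c S : ℕ → ℕ) (hm : ∀ d, Fintype.card {j // l j = d} = m d)
    (hc : ∀ d, c d = m d + c (d + 1)) (hS : ∀ q d, q ≤ d → m d + m (d + 1) ≤ S q)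
    (hanti : Antitone S) {N : ℕ} (hN : T ^ N = 0) (x y t : ℕ)
    (ht : ∀ q, x < q → q ≤ x + y → c q + c (q + 1) + (q - 1 - x) * S q ≤ t + c (x + y + 1))
    {v : V} (hv : v ∈ LinearMap.range (T ^ x) ⊓ LinearMap.ker (T ^ y)) : (A ^ t) v = 0 := by
  induction hr : (N - x) + y generalizing x y t v with
  | zero =>
    obtain rfl : y = 0 := by omega
    have : v = 0 := by simpa using hv.2
    rw [this, map_zero]
  | succ r ih =>
    rcases y with _ | y
    · have : v = 0 := by simpa using hv.2
      rw [this, map_zero]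
    rcases le_or_gt N x with hNx | hNx
    · obtain ⟨u, rfl⟩ := hv.1
      rw [pow_eq_zero_of_le hNx hN]
      simp
    have hd := ht (x + (y + 1)) (by omega) le_rfl
    have hcd := hc (x + (y + 1))
    have hmt : m (x + (y + 1)) ≤ t := by omega
    obtain ⟨t', rfl⟩ := Nat.exists_eq_add_of_le' hmt
    have hmem := pow_apply_mem_of_le_span_sup hA
      (W := LinearMap.range (T ^ x) ⊓ LinearMap.ker (T ^ (y + 1)))
      (fun v hv => ⟨mem_range_pow_of_commute hAT _ hv.1, mem_ker_pow_of_commute hAT _ hv.2⟩)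
      (Z := (LinearMap.range (T ^ (x + 1)) ⊓ LinearMap.ker (T ^ (y + 1))) ⊔
          (LinearMap.range (T ^ x) ⊓ LinearMap.ker (T ^ y)))
      (by
        intro v hv
        obtain ⟨a, ha, b, hb, rfl⟩ := Submodule.mem_sup.1 hv
        rw [map_add]
        exact Submodule.add_mem_sup
          ⟨mem_range_pow_of_commute hAT _ ha.1, mem_ker_pow_of_commute hAT _ ha.2⟩
          ⟨mem_range_pow_of_commute hAT _ hb.1, mem_ker_pow_of_commute hAT _ hb.2⟩)
      _ (h.range_inf_ker_le x y) hv
    rw [hm] at hmem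
    obtain ⟨a, ha, b, hb, hab⟩ := Submodule.mem_sup.1 hmem
    rw [pow_add, Module.End.mul_apply, ← hab, map_add,
      ih (x + 1) (y + 1) t' ?_ ha (by omega), ih x y t' ?_ hb (by omega), add_zero]
    · intro q hxq hq
      have := ht q hxq (by omega)
      rw [show x + y + 1 = x + (y + 1) by ring]
      omega
    · intro q hxq hq
      have hc1 := hc (x + (y + 1) + 1)
      rw [show x + 1 + (y + 1) + 1 = x + (y + 1) + 1 + 1 by ring]
      -- Going up one level uses one bounce: for old `q`, a copy of `S q` pays for two adjacent
      -- multiplicities. The newly allowed top `q` follows from the condition at the previous level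
      -- and monotonicity of `S`.
      rcases Nat.lt_or_ge (x + (y + 1)) q with hlt | hge
      · obtain rfl : q = x + (y + 1) + 1 := by omega
        have h1 := Nat.mul_le_mul_left (x + (y + 1) - 1 - x) (hanti (Nat.le_succ (x + (y + 1))))
        rw [show x + (y + 1) + 1 - 1 - (x + 1) = x + (y + 1) - 1 - x by omega]
        simp only [Nat.succ_eq_add_one] at h1
        omega
      · have h1 := ht q (by omega) hge
        have h2 := hS q _ hge
        rw [show q - 1 - x = q - 1 - (x + 1) + 1 by omega, add_mul, one_mul] at h1
        omega

end UpperBounds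

/-! ### The upper bound for the index of nilpotency -/

section IndexBound

/-- The number of vectors that a chain turning around at the blocks of sizes `e` and `e + 1` meets
in a block of size `p`. -/
def chainWeight (e p : ℕ) : ℕ :=
  if p < e then 0 else if p ≤ e + 1 then p else 2

/-- The length of a longest chain turning around at the blocks of sizes `e` and `e + 1`. -/
def chainLength (s : Multiset ℕ) (e : ℕ) : ℕ :=
  (s.map (chainWeight e)).sum

lemma countP_le_eq_count_add (s : Multiset ℕ) (d : ℕ) :
    s.countP (d ≤ ·) = s.count d + s.countP (d + 1 ≤ ·) := by
  induction s using Multiset.induction with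
  | empty => simp
  | cons a s ih =>
    rw [Multiset.countP_cons, Multiset.countP_cons, Multiset.count_cons, ih]
    split_ifs <;> omega

/-- Blockwise, `chainWeight e p` is $[p\ge e]+[p\ge e+1]+(e-1)([p=e]+[p=e+1])$: descent, ascent and
bounces of the walk. -/
lemma chainLength_eq (s : Multiset ℕ) {e : ℕ} (he : 1 ≤ e) :
    chainLength s e = s.countP (e ≤ ·) + s.countP (e + 1 ≤ ·) +
      (e - 1) * (s.count e + s.count (e + 1)) := by
  unfold chainLength
  induction s using Multiset.induction with
  | empty => simp
  | cons a s ih =>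
    rw [Multiset.map_cons, Multiset.sum_cons, ih, Multiset.countP_cons, Multiset.countP_cons,
      Multiset.count_cons, Multiset.count_cons]
    unfold chainWeight
    obtain ⟨e, rfl⟩ := Nat.exists_eq_add_of_le' he
    rw [Nat.add_sub_cancel]
    rcases lt_trichotomy a (e + 1) with h | h | h
    · simp only [if_pos h, if_neg (show ¬ (e + 1 ≤ a) by omega),
        if_neg (show ¬ (e + 1 + 1 ≤ a) by omega), if_neg (show ¬ (e + 1 = a) by omega),
        if_neg (show ¬ (e + 1 + 1 = a) by omega)]
      ring
    · subst h
      simp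
      ring
    · rcases eq_or_ne a (e + 1 + 1) with h' | h'
      · subst h'
        simp
        ring
      · simp only [if_neg (show ¬ (a < e + 1) by omega), if_neg (show ¬ (a ≤ e + 1 + 1) by omega),
          if_pos (show e + 1 ≤ a by omega), if_pos (show e + 1 + 1 ≤ a by omega),
          if_neg (show ¬ (e + 1 = a) by omega), if_neg (show ¬ (e + 1 + 1 = a) by omega)]
        ring

lemma countP_add_countP_le (s : Multiset ℕ) {S q e : ℕ} (hqe : q ≤ e)
    (hS : ∀ d, q ≤ d → s.count d + s.count (d + 1) ≤ S) :
    s.countP (q ≤ ·) + s.countP (q + 1 ≤ ·) ≤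
      (e - q) * S + (s.countP (e ≤ ·) + s.countP (e + 1 ≤ ·)) := by
  induction e, hqe using Nat.le_induction with
  | base => simp
  | succ e hqe ih =>
    have h1 := countP_le_eq_count_add s e
    have h2 := countP_le_eq_count_add s (e + 1)
    have h3 := hS e hqe
    rw [show e + 1 - q = e - q + 1 by omega, add_mul, one_mul]
    omega

theorem HasJordanType.pow_eq_zero_of_commute {F : Type*} [Field F] {V : Type*} [AddCommGroup V]
    [Module F V] {T A : End F V} {s : Multiset ℕ} (h : HasJordanType T s) (hA : IsNilpotent A)
    (hAT : Commute A T) {M : ℕ} (hM : ∀ e, 1 ≤ e → chainLength s e ≤ M) : A ^ M = 0 := by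
  classical
  have := h.finite
  have hN := h.pow_eq_zero_iff.2 fun p hp =>
    Multiset.single_le_sum (fun _ _ => Nat.zero_le _) p hp
  have hle : ∀ p ∈ s, p ≤ s.sum := fun p hp =>
    Multiset.single_le_sum (fun _ _ => Nat.zero_le _) p hp
  set N := s.sum with hNdef
  let S : ℕ → ℕ := fun q => (Finset.Icc q N).sup fun d => s.count d + s.count (d + 1)
  have hcount : ∀ d, N < d → s.count d = 0 := fun d hd =>
    Multiset.count_eq_zero.2 fun hmem => absurd (hle d hmem) (by omega)
  have hS : ∀ q d, q ≤ d → s.count d + s.count (d + 1) ≤ S q := by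
    intro q d hqd
    rcases le_or_gt d N with hd | hd
    · exact Finset.le_sup (f := fun d => s.count d + s.count (d + 1))
        (Finset.mem_Icc.2 ⟨hqd, hd⟩)
    · rw [hcount d hd, hcount (d + 1) (by omega)]
      exact Nat.zero_le _
  have hanti : Antitone S := fun a b hab =>
    Finset.sup_mono (Finset.Icc_subset_Icc_left hab)
  have hbound : ∀ q, 1 ≤ q →
      s.countP (q ≤ ·) + s.countP (q + 1 ≤ ·) + (q - 1) * S q ≤ M := by
    intro q hq
    -- Let `e` attain the supremum `S q`. Raising the turning level from `q` to `e` gains `e - q`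
    -- bounces and loses no more than that in the counts, so `chainLength s e` dominates.
    obtain ⟨e, hqe, he⟩ : ∃ e, q ≤ e ∧ S q = s.count e + s.count (e + 1) := by
      rcases le_or_gt q N with hqN | hqN
      · obtain ⟨e, he, heq⟩ := Finset.exists_mem_eq_sup (Finset.Icc q N) ⟨q, by simp [hqN]⟩
          fun d => s.count d + s.count (d + 1)
        exact ⟨e, (Finset.mem_Icc.1 he).1, heq⟩
      · refine ⟨q, le_rfl, ?_⟩
        have : S q = 0 := by simp [S, Finset.Icc_eq_empty_of_lt hqN]
        rw [this, hcount q hqN, hcount (q + 1) (by omega)]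
    have h1 := countP_add_countP_le s hqe (hS q)
    have h2 := hM e (by omega)
    rw [chainLength_eq s (by omega), ← he] at h2
    have h3 : (e - 1) * S q = (e - q) * S q + (q - 1) * S q := by
      rw [← add_mul]
      congr 1
      omega
    omega
  obtain ⟨ι, _, l, g, hg, hs⟩ := h
  refine LinearMap.ext fun v => ?_
  have hv : v ∈ LinearMap.range (T ^ 0) ⊓ LinearMap.ker (T ^ N) :=
    ⟨⟨v, rfl⟩, by simp [hN]⟩
  refine pow_apply_eq_zero_of_mem_range_inf_ker hg hA hAT (fun d => s.count d)
    (fun d => s.countP (d ≤ ·)) S (fun d => ?_) (countP_le_eq_count_add s) hS hanti hN 0 N M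
    (fun q hq _ => ?_) hv
  · rw [← hs, Multiset.count_map, Fintype.card_subtype, Finset.card_def, Finset.filter_val]
    simp only [eq_comm]
  · have := hbound q hq
    simp only [Nat.sub_zero]
    omega

end IndexBound

/-! ### Building long chains -/

section Construction

variable {F : Type*} [Field F] {V W : Type*} [AddCommGroup V] [Module F V]
  [AddCommGroup W] [Module F W]

/-- The operator with one Jordan block that commutes with `T` of almost rectangular type. -/
theorem HasJordanType.exists_commute_of_isAlmostRectangular {T : End F V} {s : Multiset ℕ}
    (h : HasJordanType T s) (hs : IsAlmostRectangular s) (hs0 : s ≠ 0) :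
    ∃ A : End F V, IsNilpotent A ∧ Commute A T ∧ finrank F (LinearMap.ker A) ≤ 1 := by
  have := h.finite
  have hlen : (s.sort (· ≥ ·)).length = Multiset.card s := by simp
  obtain ⟨k, hk⟩ : ∃ k, Multiset.card s = k + 1 :=
    Nat.exists_eq_succ_of_ne_zero (by simpa using hs0)
  have hlen' : (s.sort (· ≥ ·)).length = k + 1 := hlen.trans hk
  let l : Fin (k + 1) → ℕ := fun j => (s.sort (· ≥ ·)).get (Fin.cast hlen'.symm j)
  have hl : Finset.univ.val.map l = s := by
    conv_rhs => rw [← Multiset.sort_eq s (· ≥ ·), ← List.ofFn_get (s.sort (· ≥ ·))]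
    rw [List.ofFn_congr hlen', Fin.univ_val_map]
  have hanti : ∀ i j, i ≤ j → l j ≤ l i := by
    intro i j hij
    have := (Multiset.pairwise_sort s (· ≥ ·)).rel_get_of_le (a := Fin.cast hlen'.symm i)
      (b := Fin.cast hlen'.symm j) hij
    exact this
  have hmem : ∀ j, l j ∈ s := fun j => by
    rw [← hl]
    exact Multiset.mem_map_of_mem _ (Finset.mem_univ j)
  obtain ⟨g, hg⟩ := h.exists_system hl
  -- Generators in decreasing order of length are permuted cyclically, with a factor `T` on wrapping
  -- around, so that `A ^ (k + 1) = T` and `g 0` is cyclic for `A`. Almost rectangularity makes the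
  -- last assignment legal: the first chain exceeds the last by at most one.
  let w : Fin (k + 1) → V := fun j => if hj : (j : ℕ) + 1 < k + 1 then g ⟨j + 1, hj⟩ else T (g 0)
  obtain ⟨A, hAT, hAg⟩ := hg.exists_lift T w (by
    intro j
    by_cases hj : (j : ℕ) + 1 < k + 1
    · simp only [w, dif_pos hj]
      exact hg.pow_eq_zero_of_le (hanti _ _ (Fin.le_def.2 (by simp)))
    · simp only [w, dif_neg hj]
      rw [← Module.End.mul_apply, ← pow_succ]
      exact hg.pow_eq_zero_of_le (hs _ (hmem _) _ (hmem _)))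
  have hcomm : Commute A T := LinearMap.ext hAT
  have hpow : ∀ (i : ℕ) (hi : i < k + 1), (A ^ i) (g 0) = g ⟨i, hi⟩ := by
    intro i
    induction i with
    | zero => intro _; rfl
    | succ i ih =>
      intro hi
      rw [pow_succ', Module.End.mul_apply, ih (by omega), hAg]
      simp only [w, dif_pos hi]
  have hk1 : (A ^ (k + 1)) (g 0) = T (g 0) := by
    rw [pow_succ', Module.End.mul_apply, hpow k (by omega), hAg]
    simp [w]
  have hAk : A ^ (k + 1) = T := by
    refine hg.map_ext_of_intertwine (T' := T)
      (fun x => LinearMap.congr_fun (hcomm.pow_left (k + 1)).eq x) (fun x => rfl) fun j => ?_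
    rw [← hpow j j.2, ← Module.End.mul_apply, ← pow_add, add_comm, pow_add, Module.End.mul_apply,
      hk1]
    exact LinearMap.congr_fun (hcomm.pow_left j).eq (g 0)
  refine ⟨A, ?_, hcomm, ?_⟩
  · obtain ⟨N, hN⟩ := h.isNilpotent
    exact ⟨(k + 1) * N, by rw [pow_mul, hAk, hN]⟩
  · have htop : LinearMap.range A ⊔ Submodule.span F {g 0} = ⊤ := by
      rw [eq_top_iff, ← hg.basis.span_eq, Submodule.span_le]
      rintro _ ⟨⟨j, i⟩, rfl⟩
      rw [hg.basis_apply, ← hpow j j.2]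
      have hTA : (T ^ (i : ℕ)) ((A ^ (j : ℕ)) (g 0)) = (A ^ ((k + 1) * i + j)) (g 0) := by
        rw [pow_add, pow_mul, hAk, Module.End.mul_apply]
      rw [hTA]
      rcases Nat.eq_zero_or_pos ((k + 1) * i + j) with h0 | h0
      · rw [h0]
        exact Submodule.mem_sup_right (Submodule.subset_span rfl)
      · refine Submodule.mem_sup_left ⟨(A ^ ((k + 1) * i + j - 1)) (g 0), ?_⟩
        rw [← Module.End.mul_apply, ← pow_succ', Nat.sub_add_cancel h0]
    have h1 := Submodule.finrank_add_le_finrank_add_finrank (LinearMap.range A)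
      (Submodule.span F {g 0})
    rw [htop, finrank_top] at h1
    have h2 := LinearMap.finrank_range_add_finrank_ker A
    have h3 := finrank_range_le_card (R := F) fun _ : Unit => g 0
    rw [Set.finrank, Set.range_const, Fintype.card_unit] at h3
    omega

lemma exists_hasJordanType_model (F : Type*) [Field F] (s : Multiset ℕ) :
    ∃ (k : ℕ) (T : End F (Fin k → F)), HasJordanType T s := by
  obtain ⟨l, hl⟩ : ∃ l : Fin s.toList.length → ℕ, Finset.univ.val.map l = s :=
    ⟨s.toList.get, by rw [Fin.univ_val_map, List.ofFn_get, Multiset.coe_toList]⟩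
  have h := hasJordanType_blockDiagonal_jordanBlock (F := F) l
  rw [hl] at h
  let e := Fintype.equivFin (Σ j, Fin (l j))
  let E := LinearEquiv.funCongrLeft F F e.symm
  refine ⟨_, E.conj (Matrix.toLin' (Matrix.blockDiagonal' fun j => jordanBlock F (l j))),
    h.of_equiv E fun x => ?_⟩
  rw [LinearEquiv.conj_apply_apply, LinearEquiv.symm_apply_apply]

/-- The coefficient of `c` in the expansion of `(a + c b) ^ t`. -/
lemma exists_add_smul_pow_eq {E : Type*} [Ring E] [Algebra F E] (a b : E) (t : ℕ) :
    ∃ e : ℕ → E, (∀ i, t < i → e i = 0) ∧ e 0 = a ^ t ∧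
      e 1 = ∑ i ∈ Finset.range t, a ^ (t - 1 - i) * b * a ^ i ∧
      ∀ c : F, (a + c • b) ^ t = ∑ i ∈ Finset.range (t + 1), c ^ i • e i := by
  induction t with
  | zero =>
    refine ⟨fun i => if i = 0 then 1 else 0, fun i hi => if_neg hi.ne', by simp, by simp, by simp⟩
  | succ t ih =>
    obtain ⟨e, hbig, h0, h1, he⟩ := ih
    let e' : ℕ → E := fun i => Nat.casesOn i (a * e 0) fun i => a * e (i + 1) + b * e i
    have he0 : e' 0 = a * e 0 := rfl
    have hes : ∀ i, e' (i + 1) = a * e (i + 1) + b * e i := fun _ => rfl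
    refine ⟨e', fun i hi => ?_, ?_, ?_, fun c => ?_⟩
    · obtain ⟨i, rfl⟩ := Nat.exists_eq_add_of_le' (show 1 ≤ i by omega)
      rw [hes, hbig _ (by omega), hbig _ (by omega), mul_zero, mul_zero, add_zero]
    · rw [he0, h0, pow_succ']
    · rw [show e' 1 = a * e 1 + b * e 0 from rfl, Finset.sum_range_succ, h1, h0, Finset.mul_sum]
      simp only [Nat.add_sub_cancel, Nat.sub_self, pow_zero, one_mul]
      congr 1
      refine Finset.sum_congr rfl fun i hi => ?_
      have := Finset.mem_range.1 hi
      rw [show t - i = t - 1 - i + 1 by omega, pow_succ' a (t - 1 - i)]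
      simp only [mul_assoc]
    · have h2 : ∑ i ∈ Finset.range (t + 1), c ^ i • e i =
          ∑ i ∈ Finset.range (t + 1), c ^ (i + 1) • e (i + 1) + c ^ 0 • e 0 := by
        rw [← Finset.sum_range_succ' (fun i => c ^ i • e i), Finset.sum_range_succ _ (t + 1),
          hbig (t + 1) (by omega), smul_zero, add_zero]
      rw [pow_succ', he, add_mul, Finset.sum_range_succ' _ (t + 1)]
      nth_rewrite 1 [h2]
      simp only [hes, he0, mul_add, smul_add, Finset.sum_add_distrib, Finset.mul_sum, mul_smul_comm,
        smul_mul_assoc, smul_smul, ← pow_succ]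
      abel

/-- The hypothesis says that the linear coefficient of the polynomial $c\mapsto\Psi((a+cb)^t)$ is
nonzero; over an infinite field it has a non-root. -/
lemma exists_pow_add_smul_ne_zero [Infinite F] {E : Type*} [Ring E] [Algebra F E] (a b : E)
    (t : ℕ) (Ψ : E →ₗ[F] F)
    (h : Ψ (∑ i ∈ Finset.range t, a ^ (t - 1 - i) * b * a ^ i) ≠ 0) :
    ∃ c : F, (a + c • b) ^ t ≠ 0 := by
  obtain ⟨e, hbig, -, h1, he⟩ := exists_add_smul_pow_eq (F := F) a b t
  rw [← h1] at h
  let p : F[X] := ∑ i ∈ Finset.range (t + 1), Polynomial.monomial i (Ψ (e i))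
  have hp : p ≠ 0 := by
    intro hp
    have h2 : p.coeff 1 = 0 := by rw [hp, Polynomial.coeff_zero]
    simp only [p, Polynomial.finsetSum_coeff, Polynomial.coeff_monomial] at h2
    rw [Finset.sum_ite_eq' (Finset.range (t + 1)) 1, if_pos] at h2
    · exact h h2
    · rw [Finset.mem_range]
      by_contra hlt
      exact h (by rw [hbig 1 (by omega), map_zero])
  by_contra! hall
  refine hp (Polynomial.funext fun c => ?_)
  have h3 := congrArg Ψ (he c)
  rw [hall c, map_zero, map_sum] at h3
  rw [Polynomial.eval_zero, h3, Polynomial.eval_finsetSum]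
  refine Finset.sum_congr rfl fun i _ => ?_
  rw [Polynomial.eval_monomial, map_smul, smul_eq_mul, mul_comm]

lemma isNilpotent_prodMap {A : End F V} {C : End F W} (hA : IsNilpotent A) (hC : IsNilpotent C) :
    IsNilpotent (A.prodMap C) := by
  obtain ⟨a, ha⟩ := hA
  obtain ⟨c, hc⟩ := hC
  refine ⟨a + c, ?_⟩
  rw [prodMap_pow, pow_add, ha, pow_add, hc, zero_mul, mul_zero, LinearMap.prodMap_zero]

/-- Modulo the range of `T` the two operators agree, so $A^rV\subseteq TV$; by commutation
$A^{rj}V\subseteq T^jV$. -/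
lemma isNilpotent_of_sub_mem_range {T A A₀ : End F V} (hT : IsNilpotent T) (hA : Commute A T)
    (hA₀n : IsNilpotent A₀) (h : ∀ x, A x - A₀ x ∈ LinearMap.range T) :
    IsNilpotent A := by
  obtain ⟨r, hr⟩ := hA₀n
  obtain ⟨k, hk⟩ := hT
  have hpow : ∀ a x, (A ^ a) x - (A₀ ^ a) x ∈ LinearMap.range T := by
    intro a
    induction a with
    | zero => intro x; simp
    | succ a ih =>
      intro x
      rw [pow_succ', pow_succ', Module.End.mul_apply, Module.End.mul_apply,
        ← sub_add_sub_cancel _ (A ((A₀ ^ a) x)), ← map_sub]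
      refine add_mem ?_ (h _)
      obtain ⟨y, hy⟩ := ih x
      exact ⟨A y, by rw [← hy]; exact (LinearMap.congr_fun hA.eq y).symm⟩
  have hr' : ∀ x, (A ^ r) x ∈ LinearMap.range T := by
    intro x
    have := hpow r x
    rwa [hr, LinearMap.zero_apply, sub_zero] at this
  have hrange : ∀ j x, (A ^ (r * j)) x ∈ LinearMap.range (T ^ j) := by
    intro j
    induction j with
    | zero => intro x; exact ⟨x, rfl⟩
    | succ j ih =>
      intro x
      obtain ⟨y, hy⟩ := ih x
      obtain ⟨z, hz⟩ := hr' y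
      refine ⟨z, ?_⟩
      rw [mul_add, mul_one, add_comm (r * j) r, pow_add A, Module.End.mul_apply, ← hy, pow_succ,
        Module.End.mul_apply, hz]
      exact (LinearMap.congr_fun ((hA.pow_pow r j).eq) y).symm
  refine ⟨r * k, LinearMap.ext fun x => ?_⟩
  obtain ⟨y, hy⟩ := hrange k x
  rw [← hy, hk]
  rfl

/-- A nilpotent operator commuting with `T` can be extended along a direct sum with blocks that are
longer than those of `T`, so that its index grows by two for each new block. -/
theorem exists_commute_prod_pow_ne_zero [Infinite F] {T A : End F V} {J : End F W} {k p m : ℕ}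
    (hA : IsNilpotent A) (hAT : Commute A T) (hTp : T ^ p = 0) (hm : A ^ m ≠ 0)
    (hJ : HasJordanType J (Multiset.replicate (k + 1) (p + 1))) :
    ∃ C : End F (V × W), IsNilpotent C ∧ Commute C (T.prodMap J) ∧
      C ^ (m + 2 * (k + 1)) ≠ 0 := by
  have hT : IsNilpotent T := ⟨p, hTp⟩
  obtain ⟨g, hg⟩ := hJ.exists_system (κ := Fin (k + 1)) (l := fun _ => p + 1) (by simp)
  obtain ⟨v, hv⟩ : ∃ v, (A ^ m) v ≠ 0 := by
    by_contra! h
    exact hm (LinearMap.ext h)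
  have hp0 : p ≠ 0 := by
    rintro rfl
    rw [pow_zero] at hTp
    have := LinearMap.congr_fun hTp ((A ^ m) v)
    exact hv this
  obtain ⟨φ, hφ⟩ : ∃ φ : V →ₗ[F] F, φ ((A ^ m) v) ≠ 0 := by
    by_contra! h
    exact hv ((Module.forall_dual_apply_eq_zero_iff F _).1 h)
  -- The intended chain is $g_0\to\dots\to g_k\to v\to\dots\to A^mv\to J^pg_0\to\dots\to J^pg_k$,
  -- with $m+2(k+1)$ arrows. `N` moves along the new blocks, `P` enters the old ones at `v`, and `f`
  -- returns.
  obtain ⟨N, hNJ, hNg⟩ := hg.exists_lift J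
    (fun j => if hj : (j : ℕ) + 1 < k + 1 then g ⟨j + 1, hj⟩ else 0) (by
      intro j
      split_ifs
      · exact hg.pow_eq_zero _
      · exact map_zero _)
  obtain ⟨P, hPJ, hPg⟩ := hg.exists_lift T (fun j => if (j : ℕ) = k then v else 0) (by
      intro j
      rw [pow_succ', hTp, mul_zero]; rfl)
  -- Starting from `J (g 0)` rather than `g 0` keeps the values of `f` in the range of `J`, so
  -- adding a multiple of `f'` preserves nilpotency.
  obtain ⟨f, hfT, hf⟩ := exists_intertwine_of_functional T J hTp (g := J (g 0)) (by
    rw [← Module.End.mul_apply, ← pow_succ]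
    exact hg.pow_eq_zero 0) φ
  let A₀ : End F (V × W) := (A.coprod P).prod (N ∘ₗ LinearMap.snd F V W)
  let f' : End F (V × W) := LinearMap.inr F V W ∘ₗ f ∘ₗ LinearMap.fst F V W
  have hA₀ : ∀ x y, A₀ (x, y) = (A x + P y, N y) := fun x y => by simp [A₀]
  have hf' : ∀ x y, f' (x, y) = (0, f x) := fun x y => by simp [f']
  have hA₀T : Commute A₀ (T.prodMap J) := by
    refine LinearMap.ext fun ⟨x, y⟩ => ?_
    have := LinearMap.congr_fun hAT.eq x
    simp only [Module.End.mul_apply] at this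
    simp [hA₀, hPJ, hNJ, this]
  have hfT' : Commute f' (T.prodMap J) := by
    refine LinearMap.ext fun ⟨x, y⟩ => ?_
    simp [hf', hfT]
  have hsnd : ∀ a x y, ((A₀ ^ a) (x, y)).2 = (N ^ a) y := by
    intro a
    induction a with
    | zero => intro x y; rfl
    | succ a ih => intro x y; rw [pow_succ, Module.End.mul_apply, hA₀, ih, pow_succ]; rfl
  have hfst : ∀ a x, (A₀ ^ a) (x, 0) = ((A ^ a) x, 0) := by
    intro a
    induction a with
    | zero => intro x; rfl
    | succ a ih => intro x; rw [pow_succ, Module.End.mul_apply, hA₀, map_zero, map_zero, add_zero,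
        ih, pow_succ]; rfl
  have hNpow : ∀ a (j : Fin (k + 1)), (N ^ a) (g j) =
      if hj : (j : ℕ) + a < k + 1 then g ⟨j + a, hj⟩ else 0 := by
    intro a
    induction a with
    | zero => intro j; rw [dif_pos (by omega)]; rfl
    | succ a ih =>
      intro j
      rw [pow_succ', Module.End.mul_apply, ih]
      by_cases hj : (j : ℕ) + a < k + 1
      · rw [dif_pos hj, hNg]
        rfl
      · rw [dif_neg hj, map_zero, dif_neg (by omega)]
  have hNJc : Commute N J := LinearMap.ext hNJ
  have hNnil : N ^ (k + 1) = 0 := by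
    refine hg.map_ext_of_intertwine (T' := J)
      (fun x => LinearMap.congr_fun (hNJc.pow_left (k + 1)).eq x) (fun x => by simp) fun j => ?_
    rw [hNpow, dif_neg (by omega)]; rfl
  have hA₀nil : IsNilpotent A₀ := by
    obtain ⟨r, hr⟩ := hA
    refine ⟨r + (k + 1), LinearMap.ext fun ⟨x, y⟩ => ?_⟩
    rw [pow_add, Module.End.mul_apply]
    have h1 := hsnd (k + 1) x y
    rw [hNnil, LinearMap.zero_apply] at h1
    obtain ⟨z, hz⟩ : ∃ z, (A₀ ^ (k + 1)) (x, y) = (z, 0) := ⟨_, Prod.ext rfl h1⟩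
    rw [hz, hfst, hr]; rfl
  have hA₀g : ∀ b, (A₀ ^ b) ((0 : V), g 0) =
      if hb : b < k + 1 then (0, g ⟨b, hb⟩) else ((A ^ (b - (k + 1))) v, 0) := by
    intro b
    induction b with
    | zero => simp
    | succ b ih =>
      rw [pow_succ', Module.End.mul_apply, ih]
      rcases lt_trichotomy b k with hb | rfl | hb
      · rw [dif_pos (by omega), dif_pos (by omega), hA₀, map_zero, hPg, hNg]
        simp only
        rw [if_neg (by omega), dif_pos (by omega), add_zero]
      · rw [dif_pos (by omega), dif_neg (by omega), hA₀, map_zero, hPg, hNg]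
        simp
      · rw [dif_neg (by omega), dif_neg (by omega), hA₀, map_zero, map_zero,
          ← Module.End.mul_apply, ← pow_succ', add_zero]
        congr 3
        omega
  let ψ : W →ₗ[F] F := hg.basis.coord ⟨⟨k, by omega⟩, ⟨p, by omega⟩⟩
  have hψ : ∀ (a e : ℕ), e < p → ψ ((N ^ a) ((J ^ (p - 1 - e)) (J (g 0)))) =
      if a = k ∧ e = 0 then 1 else 0 := by
    intro a e he
    rw [← Module.End.mul_apply (J ^ _) J, ← pow_succ, show p - 1 - e + 1 = p - e by omega,
      ← Module.End.mul_apply, ((hNJc.pow_left a).pow_right (p - e)).eq, Module.End.mul_apply, hNpow]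
    simp only [ψ]
    by_cases ha : a < k + 1
    · rw [dif_pos (by simpa using ha), hg.coord_pow, if_pos (by simp)]
      have h1 := hg.basis_apply ⟨(0 : Fin (k + 1)) + a, by simpa using ha⟩ ⟨0, by omega⟩
      simp only [pow_zero, Module.End.one_apply] at h1
      rw [← h1, Basis.coord_apply, Basis.repr_self, Finsupp.single_apply]
      congr 1
      rw [eq_iff_iff]
      constructor
      · intro heq
        obtain ⟨h2, h3⟩ := Sigma.mk.inj heq
        have h2' := congrArg Fin.val h2
        have h3' := congrArg Fin.val (eq_of_heq h3)
        simp at h2' h3'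
        omega
      · rintro ⟨rfl, rfl⟩
        simp
    · rw [dif_neg (by simpa using ha), map_zero, map_zero, if_neg (by omega)]
  let Ψ : End F (V × W) →ₗ[F] F :=
    ψ ∘ₗ LinearMap.snd F V W ∘ₗ LinearMap.applyₗ ((0 : V), g 0)
  obtain ⟨c, hc⟩ := exists_pow_add_smul_ne_zero A₀ f' (m + 2 * (k + 1)) Ψ (by
    have hΨ : ∀ a b, Ψ (A₀ ^ a * f' * A₀ ^ b) =
        if a = k ∧ k + 1 ≤ b then φ ((A ^ (b - (k + 1))) v) else 0 := by
      intro a b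
      have h1 : Ψ (A₀ ^ a * f' * A₀ ^ b) = ψ ((A₀ ^ a) (f' ((A₀ ^ b) (0, g 0)))).2 := rfl
      rw [h1, hA₀g]
      by_cases hb : b < k + 1
      · rw [dif_pos hb, hf', hsnd, map_zero, map_zero, map_zero, if_neg (by omega)]
      · rw [dif_neg hb, hf', hsnd, hf]
        simp only [map_sum, map_smul, smul_eq_mul]
        rw [Finset.sum_congr rfl fun e he => by rw [hψ a e (Finset.mem_range.1 he)]]
        by_cases ha : a = k
        · rw [if_pos ⟨ha, by omega⟩, Finset.sum_eq_single 0]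
          · simp [ha]
          · intro e _ he
            simp [he]
          · simp [Nat.pos_of_ne_zero hp0]
        · simp [ha]
    -- With `f'` used exactly once, after `m + (k + 1)` steps, exactly `k` steps remain to reach the
    -- block of $g_k$; every other position contributes 0.
    rw [map_sum, Finset.sum_eq_single (m + (k + 1))]
    · rw [hΨ, if_pos ⟨by omega, by omega⟩, Nat.add_sub_cancel]
      exact hφ
    · intro b hb hne
      rw [hΨ, if_neg]
      have := Finset.mem_range.1 hb
      omega
    · intro hmem
      rw [Finset.mem_range] at hmem
      omega)
  have hCT : Commute (A₀ + c • f') (T.prodMap J) := hA₀T.add_left (hfT'.smul_left c)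
  have hTJ : IsNilpotent (T.prodMap J) := isNilpotent_prodMap hT hJ.isNilpotent
  refine ⟨A₀ + c • f', isNilpotent_of_sub_mem_range hTJ hCT hA₀nil ?_, hCT, hc⟩
  rintro ⟨x, y⟩
  rw [LinearMap.add_apply, add_sub_cancel_left, LinearMap.smul_apply, hf', hf]
  refine Submodule.smul_mem _ _ ⟨(0, ∑ e ∈ Finset.range p,
    φ ((T ^ e) x) • (J ^ (p - 1 - e)) (g 0)), ?_⟩
  rw [LinearMap.prodMap_apply, map_zero, map_sum]
  congr 1
  refine Finset.sum_congr rfl fun e _ => ?_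
  rw [map_smul, ← Module.End.mul_apply, ← Module.End.mul_apply, ← pow_succ', ← pow_succ]

end Construction

/-! ### Commuting operators with few blocks or large index -/

section Existence

variable {F : Type*} [Field F] {V W : Type*} [AddCommGroup V] [Module F V]
  [AddCommGroup W] [Module F W]

lemma HasJordanType.exists_commute_of_model {T : End F V} {J : End F W} {s : Multiset ℕ}
    (h : HasJordanType T s) (h' : HasJordanType J s) {C : End F W} (hC : IsNilpotent C)
    (hCJ : Commute C J) :
    ∃ A : End F V, IsNilpotent A ∧ Commute A T ∧ (∀ m, A ^ m = 0 → C ^ m = 0) ∧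
      finrank F (LinearMap.ker A) = finrank F (LinearMap.ker C) := by
  obtain ⟨e, he⟩ := h'.exists_equiv h
  have hT : e.conjRingEquiv J = T := by
    refine LinearMap.ext fun x => ?_
    change e (J (e.symm x)) = T x
    rw [he, LinearEquiv.apply_symm_apply]
  refine ⟨e.conjRingEquiv C, ?_, ?_, fun m hm => ?_, ?_⟩
  · obtain ⟨r, hr⟩ := hC
    exact ⟨r, by rw [← map_pow, hr, map_zero]⟩
  · rw [← hT]
    exact hCJ.map e.conjRingEquiv
  · rw [← map_pow] at hm
    exact e.conjRingEquiv.injective (by rw [hm, map_zero])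
  · have hker : LinearMap.ker (e.conjRingEquiv C) =
        (LinearMap.ker C).map (e : W →ₗ[F] V) := by
      ext x
      rw [LinearMap.mem_ker, Submodule.mem_map]
      change e (C (e.symm x)) = 0 ↔ _
      rw [LinearEquiv.map_eq_zero_iff]
      constructor
      · intro hx
        exact ⟨e.symm x, hx, e.apply_symm_apply x⟩
      · rintro ⟨y, hy, rfl⟩
        simpa using hy
    rw [hker]
    exact LinearEquiv.finrank_map_eq e _

/-- A union of two almost rectangular partitions admits a commuting nilpotent operator with at most
two Jordan blocks. -/
theorem HasJordanType.exists_commute_finrank_ker_le_two {T : End F V} {s₁ s₂ : Multiset ℕ}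
    (h : HasJordanType T (s₁ + s₂)) (hs₁ : IsAlmostRectangular s₁) (hs₂ : IsAlmostRectangular s₂)
    (h₁ : s₁ ≠ 0) (h₂ : s₂ ≠ 0) :
    ∃ A : End F V, IsNilpotent A ∧ Commute A T ∧ finrank F (LinearMap.ker A) ≤ 2 := by
  obtain ⟨_, J₁, hJ₁⟩ := exists_hasJordanType_model F s₁
  obtain ⟨_, J₂, hJ₂⟩ := exists_hasJordanType_model F s₂
  obtain ⟨A₁, hA₁, hc₁, hk₁⟩ := hJ₁.exists_commute_of_isAlmostRectangular hs₁ h₁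
  obtain ⟨A₂, hA₂, hc₂, hk₂⟩ := hJ₂.exists_commute_of_isAlmostRectangular hs₂ h₂
  have hcomm : Commute (A₁.prodMap A₂) (J₁.prodMap J₂) := by
    rw [commute_iff_eq, LinearMap.prodMap_mul, LinearMap.prodMap_mul, hc₁.eq, hc₂.eq]
  obtain ⟨A, hA, hAT, -, hker⟩ := h.exists_commute_of_model (hJ₁.prod hJ₂)
    (isNilpotent_prodMap hA₁ hA₂) hcomm
  refine ⟨A, hA, hAT, ?_⟩
  rw [hker]
  let f : LinearMap.ker (A₁.prodMap A₂) →ₗ[F] LinearMap.ker A₁ × LinearMap.ker A₂ :=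
    LinearMap.prod
      ((LinearMap.fst F _ _ ∘ₗ (LinearMap.ker (A₁.prodMap A₂)).subtype).codRestrict _
        fun x => congrArg Prod.fst x.2)
      ((LinearMap.snd F _ _ ∘ₗ (LinearMap.ker (A₁.prodMap A₂)).subtype).codRestrict _
        fun x => congrArg Prod.snd x.2)
  have hf : Function.Injective f := by
    intro x y hxy
    have h1 := congrArg (fun z => (LinearMap.ker A₁).subtype z.1) hxy
    have h2 := congrArg (fun z => (LinearMap.ker A₂).subtype z.2) hxy
    exact Subtype.ext (Prod.ext h1 h2)
  have := LinearMap.finrank_le_finrank_of_injective hf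
  rw [Module.finrank_prod] at this
  omega

lemma chainLength_add (s s' : Multiset ℕ) (e : ℕ) :
    chainLength (s + s') e = chainLength s e + chainLength s' e := by
  simp [chainLength]

lemma chainLength_eq_sum {s : Multiset ℕ} {e : ℕ} (h : ∀ p ∈ s, e ≤ p ∧ p ≤ e + 1) :
    chainLength s e = s.sum := by
  unfold chainLength
  conv_rhs => rw [← Multiset.map_id s]
  refine congrArg Multiset.sum (Multiset.map_congr rfl fun p hp => ?_)
  obtain ⟨h1, h2⟩ := h p hp
  rw [chainWeight, if_neg (by omega), if_pos h2, id]

lemma chainLength_eq_zero {s : Multiset ℕ} {e : ℕ} (h : ∀ p ∈ s, p < e) :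
    chainLength s e = 0 := by
  unfold chainLength
  refine Multiset.sum_eq_zero fun x hx => ?_
  obtain ⟨p, hp, rfl⟩ := Multiset.mem_map.1 hx
  rw [chainWeight, if_pos (h p hp)]

/-- Block sizes are admitted one at a time. Sizes `e` and `e + 1` alone are almost rectangular and
carry a single-block operator; each larger size is attached by `exists_commute_prod_pow_ne_zero`.
Models on `Fin k → F` let the space change along the induction. -/
lemma exists_model_pow_ne_zero (F : Type*) [Field F] [Infinite F] (s : Multiset ℕ) {e p : ℕ}
    (he : 1 ≤ e) (hp : e + 1 ≤ p) (hne : ∃ a ∈ s, e ≤ a ∧ a ≤ e + 1) :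
    ∃ (k : ℕ) (T A : End F (Fin k → F)),
      HasJordanType T (s.filter fun a => e ≤ a ∧ a ≤ p) ∧ IsNilpotent A ∧ Commute A T ∧
      A ^ (chainLength (s.filter fun a => e ≤ a ∧ a ≤ p) e - 1) ≠ 0 ∧
      0 < chainLength (s.filter fun a => e ≤ a ∧ a ≤ p) e := by
  induction p, hp using Nat.le_induction with
  | base =>
    obtain ⟨a, ha, ha1, ha2⟩ := hne
    set s' := s.filter fun a => e ≤ a ∧ a ≤ e + 1 with hs'
    have hmem : ∀ x ∈ s', e ≤ x ∧ x ≤ e + 1 := fun x hx => (Multiset.mem_filter.1 hx).2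
    have has' : a ∈ s' := Multiset.mem_filter.2 ⟨ha, ha1, ha2⟩
    have har : IsAlmostRectangular s' := by
      intro x hx y hy
      have := hmem x hx
      have := hmem y hy
      omega
    have hlen := chainLength_eq_sum hmem
    have hpos : 0 < s'.sum := lt_of_lt_of_le (by omega)
      (Multiset.single_le_sum (fun _ _ => Nat.zero_le _) a has')
    obtain ⟨k, T, hT⟩ := exists_hasJordanType_model F s'
    obtain ⟨A, hA, hAT, hker⟩ := hT.exists_commute_of_isAlmostRectangular har
      (fun h => by rw [h] at has'; exact Multiset.notMem_zero a has')
    refine ⟨k, T, A, hT, hA, hAT, ?_, hlen ▸ hpos⟩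
    intro h0
    have h1 := finrank_ker_pow_le A (chainLength s' e - 1)
    rw [h0, LinearMap.ker_zero, finrank_top, hT.finrank_eq, hlen] at h1
    have h2 : (s'.sum - 1) * finrank F (LinearMap.ker A) ≤ s'.sum - 1 :=
      mul_le_of_le_one_right (Nat.zero_le _) hker
    omega
  | succ p hp ih =>
    obtain ⟨k, T, A, hT, hA, hAT, hpow, hpos⟩ := ih
    have hsplit : (s.filter fun a => e ≤ a ∧ a ≤ p + 1) =
        (s.filter fun a => e ≤ a ∧ a ≤ p) + Multiset.replicate (s.count (p + 1)) (p + 1) := by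
      rw [← Multiset.filter_eq', Multiset.filter_add_filter]
      have h1 : (s.filter fun a => (e ≤ a ∧ a ≤ p) ∧ a = p + 1) = 0 :=
        Multiset.filter_eq_nil.2 fun a _ h => by omega
      rw [h1, add_zero]
      exact Multiset.filter_congr fun a _ => by omega
    rcases Nat.eq_zero_or_pos (s.count (p + 1)) with h0 | h0
    · rw [hsplit, h0, Multiset.replicate_zero, add_zero]
      exact ⟨k, T, A, hT, hA, hAT, hpow, hpos⟩
    · obtain ⟨c, hc⟩ := Nat.exists_eq_succ_of_ne_zero h0.ne'
      rw [hc] at hsplit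
      set s' := s.filter fun a => e ≤ a ∧ a ≤ p with hs'
      obtain ⟨_, J, hJ⟩ := exists_hasJordanType_model F (Multiset.replicate (c + 1) (p + 1))
      have hTp : T ^ p = 0 := hT.pow_eq_zero_iff.2 fun a ha => (Multiset.mem_filter.1 ha).2.2
      obtain ⟨C, hC, hCT, hCpow⟩ := exists_commute_prod_pow_ne_zero hA hAT hTp hpow hJ
      rw [hsplit]
      have hlen : chainLength (Multiset.replicate (c + 1) (p + 1)) e = 2 * (c + 1) := by
        rw [chainLength, Multiset.map_replicate, Multiset.sum_replicate, chainWeight,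
          if_neg (by omega), if_neg (by omega), smul_eq_mul, mul_comm]
      obtain ⟨k', T', hT'⟩ :=
        exists_hasJordanType_model F (s' + Multiset.replicate (c + 1) (p + 1))
      obtain ⟨A', hA', hAT', hpow', -⟩ := hT'.exists_commute_of_model (hT.prod hJ) hC hCT
      refine ⟨k', T', A', hT', hA', hAT', fun h => hCpow ?_, ?_⟩
      · rw [chainLength_add, hlen] at h
        have := hpow' _ h
        rwa [show chainLength s' e + 2 * (c + 1) - 1 = chainLength s' e - 1 + 2 * (c + 1) by
          omega] at this
      · rw [chainLength_add]
        omega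

theorem HasJordanType.exists_commute_pow_ne_zero [Infinite F] {T : End F V} {s : Multiset ℕ}
    (h : HasJordanType T s) {e : ℕ} (he : 1 ≤ e) (hne : ∃ a ∈ s, e ≤ a ∧ a ≤ e + 1) :
    ∃ A : End F V, IsNilpotent A ∧ Commute A T ∧ A ^ (chainLength s e - 1) ≠ 0 := by
  obtain ⟨k, T₁, A₁, hT₁, hA₁, hc₁, hpow, -⟩ := exists_model_pow_ne_zero F s (p := s.sum + e + 1)
    he (by omega) hne
  set s₁ := s.filter fun a => e ≤ a ∧ a ≤ s.sum + e + 1 with hs₁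
  set s₂ := s.filter fun a => ¬ (e ≤ a ∧ a ≤ s.sum + e + 1) with hs₂
  have hs : s₁ + s₂ = s := Multiset.filter_add_not _ _
  obtain ⟨_, T₂, hT₂⟩ := exists_hasJordanType_model F s₂
  have hlen : chainLength s e = chainLength s₁ e := by
    rw [← hs, chainLength_add, chainLength_eq_zero (s := s₂), add_zero]
    intro p hp
    obtain ⟨hp1, hp2⟩ := Multiset.mem_filter.1 hp
    have := Multiset.single_le_sum (fun _ _ => Nat.zero_le _) p hp1
    omega
  have hT := hT₁.prod hT₂
  rw [hs] at hT
  -- Only blocks smaller than `e` remain in `s₂`, as `s.sum + e + 1` exceeds every part; they have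
  -- weight 0 and the operator is 0 there.
  have hcomm : Commute (A₁.prodMap 0) (T₁.prodMap T₂) := by
    rw [commute_iff_eq, LinearMap.prodMap_mul, LinearMap.prodMap_mul, hc₁.eq, zero_mul, mul_zero]
  obtain ⟨A, hA, hAT, hApow, -⟩ := h.exists_commute_of_model hT
    (isNilpotent_prodMap hA₁ IsNilpotent.zero) hcomm
  refine ⟨A, hA, hAT, fun h0 => hpow ?_⟩
  have h1 := hApow _ h0
  rw [prodMap_pow, hlen] at h1
  refine LinearMap.ext fun x => ?_
  exact congrArg Prod.fst (LinearMap.congr_fun h1 (x, 0))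

end Existence

/-! ### Comparing `indexCandidates` with chain lengths -/

section Candidates

variable {n : ℕ} (lam : n.Partition)

lemma part_antitone {i j : ℕ} (hi : 1 ≤ i) (hij : i ≤ j) : part lam j ≤ part lam i := by
  unfold part
  rcases lt_or_ge (j - 1) (lam.parts.sort (· ≥ ·)).length with hj | hj
  · have hi' : i - 1 < (lam.parts.sort (· ≥ ·)).length := by omega
    rw [List.getD_eq_getElem _ _ hj, List.getD_eq_getElem _ _ hi']
    have := (Multiset.pairwise_sort lam.parts (· ≥ ·)).rel_get_of_le (a := ⟨i - 1, hi'⟩)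
      (b := ⟨j - 1, hj⟩) (Fin.le_def.2 (by simp; omega))
    exact this
  · rw [List.getD_eq_default _ _ hj]
    exact Nat.zero_le _

lemma mem_parts_iff (p : ℕ) :
    p ∈ lam.parts ↔ ∃ j, 1 ≤ j ∧ j ≤ Multiset.card lam.parts ∧ part lam j = p := by
  conv_lhs => rw [← map_part lam]
  simp only [Multiset.mem_map, Finset.mem_val, Finset.mem_univ, true_and]
  constructor
  · rintro ⟨j, rfl⟩
    exact ⟨j + 1, by omega, by omega, rfl⟩
  · rintro ⟨j, h1, h2, rfl⟩
    exact ⟨⟨j - 1, by omega⟩, by simp [Nat.sub_add_cancel h1]⟩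

lemma part_mem {j : ℕ} (h1 : 1 ≤ j) (h2 : j ≤ Multiset.card lam.parts) :
    part lam j ∈ lam.parts :=
  (mem_parts_iff lam _).2 ⟨j, h1, h2, rfl⟩

lemma sum_map_parts (f : ℕ → ℕ) :
    (lam.parts.map f).sum = ∑ j ∈ Finset.Icc 1 (Multiset.card lam.parts), f (part lam j) := by
  have h : ∀ (k : ℕ) (h : ℕ → ℕ), ∑ j ∈ Finset.Icc 1 k, h j = ∑ j : Fin k, h (j + 1) := by
    intro k h
    induction k with
    | zero => simp
    | succ k ih => rw [Finset.sum_Icc_succ_top (by omega), ih, Fin.sum_univ_castSucc]; rfl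
  rw [h]
  conv_lhs => rw [← map_part lam]
  rw [Multiset.map_map]
  rfl

lemma sum_Icc_split (f : ℕ → ℕ) {i k : ℕ} (hi : 1 ≤ i) (hik : i ≤ k + 1) :
    ∑ j ∈ Finset.Icc 1 k, f j =
      ∑ j ∈ Finset.Icc 1 (i - 1), f j + ∑ j ∈ Finset.Icc i k, f j := by
  rw [← Finset.sum_union]
  · congr 1
    ext j
    simp only [Finset.mem_union, Finset.mem_Icc]
    omega
  · rw [Finset.disjoint_left]
    intro j
    simp only [Finset.mem_Icc]
    omega

lemma exists_le_chainLength_of_mem_indexCandidates {m : ℕ} (hm : m ∈ indexCandidates lam) :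
    ∃ e, 1 ≤ e ∧ m ≤ chainLength lam.parts e := by
  obtain ⟨i, r, hi, hil, hir, har, hpre, rfl⟩ := hm
  suffices H : ∃ e, 1 ≤ e ∧ (∀ j, 1 ≤ j → j ≤ i - 1 → 2 ≤ chainWeight e (part lam j)) ∧
      ∀ j, i ≤ j → j ≤ i + r → part lam j ≤ chainWeight e (part lam j) by
    obtain ⟨e, he, h1, h2⟩ := H
    refine ⟨e, he, ?_⟩
    rw [chainLength, sum_map_parts, sum_Icc_split _ (i := i + r + 1) (by omega) (by omega),
      Nat.add_sub_cancel, sum_Icc_split _ hi (by omega), add_assoc]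
    refine add_le_add ?_ (le_add_right (Finset.sum_le_sum fun j hj => ?_))
    · have := Finset.card_nsmul_le_sum (Finset.Icc 1 (i - 1)) (fun j => chainWeight e (part lam j)) 2
        fun j hj => h1 j (Finset.mem_Icc.1 hj).1 (Finset.mem_Icc.1 hj).2
      rw [Nat.card_Icc, smul_eq_mul, Nat.add_sub_cancel, mul_comm] at this
      exact this
    · exact h2 j (Finset.mem_Icc.1 hj).1 (Finset.mem_Icc.1 hj).2
  -- Normally `e = part lam i - 1`, so the run sits in `{e, e + 1}` and earlier parts weigh at least
  -- 2. If `part lam i < 2` that `e` would drop below 1; with `e = 1`, the condition on the part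
  -- before `i` keeps the weight 2.
  rcases Nat.lt_or_ge (part lam i) 2 with ha | ha
  · refine ⟨1, le_rfl, fun j hj1 hj2 => ?_, fun j hj1 hj2 => ?_⟩
    · have h1 := hpre (by omega)
      have h2 := part_antitone lam hj1 hj2
      unfold chainWeight
      split_ifs <;> omega
    · have h1 := part_antitone lam hi hj1
      unfold chainWeight
      split_ifs <;> omega
  · refine ⟨part lam i - 1, by omega, fun j hj1 hj2 => ?_, fun j hj1 hj2 => ?_⟩
    · have h1 := part_antitone lam hj1 (show j ≤ i by omega)
      unfold chainWeight
      split_ifs <;> omega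
    · have h1 := part_antitone lam hi hj1
      have h2 := part_antitone lam (show 1 ≤ j by omega) hj2
      unfold chainWeight
      split_ifs <;> omega

/-- The parts in `{e, e + 1}` form a run of indices `i, …, k` and the chain length is the candidate
for that run, except that `i = l` is not admitted. Only this exception needs the two almost
rectangular pieces. -/
lemma exists_mem_indexCandidates_ge {c₁ c₂ : Multiset ℕ} (hsum : c₁ + c₂ = lam.parts)
    (hc₁ : IsAlmostRectangular c₁) (hc₂ : IsAlmostRectangular c₂) (h₁ : c₁ ≠ 0) (h₂ : c₂ ≠ 0)
    {e : ℕ} (he : 1 ≤ e) (hne : ∃ a ∈ lam.parts, e ≤ a ∧ a ≤ e + 1) :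
    ∃ m ∈ indexCandidates lam, chainLength lam.parts e ≤ m := by
  have hcard : 2 ≤ Multiset.card lam.parts := by
    rw [← hsum, Multiset.card_add]
    have := Multiset.card_pos.2 h₁
    have := Multiset.card_pos.2 h₂
    omega
  set l := Multiset.card lam.parts with hl
  obtain ⟨a, ha, hea, hae⟩ := hne
  obtain ⟨ja, hja1, hjal, rfl⟩ := (mem_parts_iff lam a).1 ha
  obtain ⟨i, hi1, hie, hile, himin⟩ : ∃ i, 1 ≤ i ∧ part lam i ≤ e + 1 ∧ i ≤ ja ∧
      ∀ j, 1 ≤ j → j < i → e + 1 < part lam j := by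
    classical
    have hex : ∃ i, 1 ≤ i ∧ part lam i ≤ e + 1 := ⟨ja, hja1, hae⟩
    refine ⟨Nat.find hex, (Nat.find_spec hex).1, (Nat.find_spec hex).2,
      Nat.find_min' hex ⟨hja1, hae⟩, fun j hj1 hj => ?_⟩
    by_contra! h
    exact Nat.find_min hex hj ⟨hj1, h⟩
  obtain ⟨k, hkl, hke, hkj, hkmax⟩ : ∃ k, k ≤ l ∧ e ≤ part lam k ∧ ja ≤ k ∧
      ∀ j, k < j → j ≤ l → part lam j < e := by
    refine ⟨Nat.findGreatest (fun j => e ≤ part lam j) l, Nat.findGreatest_le l,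
      Nat.findGreatest_spec (P := fun j => e ≤ part lam j) hjal hea, Nat.le_findGreatest hjal hea,
      fun j hj1 hj2 => ?_⟩
    by_contra! h
    exact Nat.findGreatest_is_greatest hj1 hj2 h
  have hlen : chainLength lam.parts e = 2 * (i - 1) + ∑ j ∈ Finset.Icc i k, part lam j := by
    rw [chainLength, sum_map_parts, sum_Icc_split _ (i := k + 1) (by omega) (by omega),
      Nat.add_sub_cancel, sum_Icc_split _ hi1 (by omega)]
    have h1 : ∑ j ∈ Finset.Icc 1 (i - 1), chainWeight e (part lam j) = 2 * (i - 1) := by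
      rw [Finset.sum_const_nat (m := 2), Nat.card_Icc, Nat.add_sub_cancel, mul_comm]
      intro j hj
      have := himin j (Finset.mem_Icc.1 hj).1 (by have := (Finset.mem_Icc.1 hj).2; omega)
      unfold chainWeight
      split_ifs <;> omega
    have h2 : ∑ j ∈ Finset.Icc i k, chainWeight e (part lam j) =
        ∑ j ∈ Finset.Icc i k, part lam j := by
      refine Finset.sum_congr rfl fun j hj => ?_
      obtain ⟨hj1, hj2⟩ := Finset.mem_Icc.1 hj
      have := part_antitone lam hi1 hj1
      have := part_antitone lam (hi1.trans hj1) hj2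
      unfold chainWeight
      split_ifs <;> omega
    have h3 : ∑ j ∈ Finset.Icc (k + 1) l, chainWeight e (part lam j) = 0 := by
      refine Finset.sum_eq_zero fun j hj => ?_
      obtain ⟨hj1, hj2⟩ := Finset.mem_Icc.1 hj
      rw [chainWeight, if_pos (hkmax j hj1 hj2)]
    rw [h1, h2, h3, add_zero]
  rcases Nat.lt_or_ge i l with hil | hil
  · refine ⟨_, ⟨i, k - i, hi1, hil, by omega, ?_, fun h => ?_, rfl⟩, ?_⟩
    · rw [Nat.add_sub_cancel' (by omega)]
      omega
    · have := himin (i - 1) (by omega) (by omega)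
      omega
    · rw [hlen, Nat.add_sub_cancel' (by omega)]
  · obtain rfl : i = l := by omega
    obtain rfl : k = l := by omega
    rw [Finset.Icc_self, Finset.sum_singleton] at hlen
    have hprev := himin (l - 1) (by omega) (by omega)
    -- When only the last part is in the run: if the part before it is close, the run is extended to
    -- include it. Otherwise the first `l - 1` parts are almost rectangular, each at least `part lam
    -- l + 2`, and their sum is large enough.
    rcases le_or_gt (part lam (l - 1)) (part lam l + 1) with h | h
    · refine ⟨_, ⟨l - 1, 1, by omega, by omega, by omega, ?_, fun h => ?_, rfl⟩, ?_⟩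
      · rwa [Nat.sub_add_cancel (by omega)]
      · have := part_antitone lam (show 1 ≤ l - 1 - 1 by omega) (show l - 1 - 1 ≤ l - 1 by omega)
        omega
      · rw [hlen, Finset.sum_Icc_succ_top (by omega), Finset.Icc_self, Finset.sum_singleton,
          Nat.sub_add_cancel (by omega)]
        omega
    · have hone := part_antitone lam le_rfl (show 1 ≤ l - 1 by omega)
      have hmem1 := part_mem lam le_rfl (show 1 ≤ l by omega)
      have hmem2 := part_mem lam (show 1 ≤ l - 1 by omega) (show l - 1 ≤ l by omega)
      have hmem3 := part_mem lam (show 1 ≤ l by omega) le_rfl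
      have har : part lam 1 ≤ part lam (l - 1) + 1 := by
        rw [← hsum, Multiset.mem_add] at hmem1 hmem2 hmem3
        rcases hmem3 with h3 | h3
        · rcases hmem1 with h1 | h1
          · have := hc₁ _ h1 _ h3
            omega
          rcases hmem2 with h2 | h2
          · have := hc₁ _ h2 _ h3
            omega
          exact hc₂ _ h1 _ h2
        · rcases hmem1 with h1 | h1
          · rcases hmem2 with h2 | h2
            · exact hc₁ _ h1 _ h2
            · have := hc₂ _ h2 _ h3
              omega
          · have := hc₂ _ h1 _ h3
            omega
      refine ⟨_, ⟨1, l - 2, le_rfl, by omega, by omega, ?_, fun h => absurd h (by omega), rfl⟩, ?_⟩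
      · rwa [show 1 + (l - 2) = l - 1 by omega]
      · rw [hlen, show 1 + (l - 2) = l - 1 by omega]
        have h4 := Finset.card_nsmul_le_sum (Finset.Icc 1 (l - 1)) (fun j => part lam j)
          (part lam l + 2) fun j hj => by
            have := part_antitone lam (Finset.mem_Icc.1 hj).1 (Finset.mem_Icc.1 hj).2
            omega
        rw [Nat.card_Icc, smul_eq_mul, Nat.add_sub_cancel] at h4
        have h5 : part lam l ≤ (l - 1) * part lam l := Nat.le_mul_of_pos_left _ (by omega)
        rw [mul_add] at h4
        omega

lemma exists_chainLength_ge {s : Multiset ℕ} (hs : ∀ p ∈ s, 0 < p) (hs0 : s ≠ 0) {e : ℕ}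
    (he : 1 ≤ e) : ∃ e', 1 ≤ e' ∧ (∃ a ∈ s, e' ≤ a ∧ a ≤ e' + 1) ∧
      chainLength s e ≤ chainLength s e' := by
  classical
  by_cases hne : ∃ a ∈ s, e ≤ a ∧ a ≤ e + 1
  · exact ⟨e, he, hne, le_rfl⟩
  by_cases hge : ∃ a, a ∈ s ∧ e ≤ a
  · obtain ⟨hmem, hle⟩ := Nat.find_spec hge
    have hmin : ∀ p ∈ s, e ≤ p → Nat.find hge ≤ p := fun p hp hep => Nat.find_min' hge ⟨hp, hep⟩
    set a := Nat.find hge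
    have ha : e + 1 < a := by
      by_contra! h
      exact hne ⟨a, hmem, hle, h⟩
    -- No part lies in `[e, a)`, so raising `e` to `a - 1` lowers no weight.
    refine ⟨a - 1, by omega, ⟨a, hmem, by omega, by omega⟩, ?_⟩
    refine Multiset.sum_map_le_sum_map _ _ fun p hp => ?_
    have := hmin p hp
    unfold chainWeight
    split_ifs <;> omega
  · obtain ⟨a, ha⟩ := Multiset.exists_mem_of_ne_zero hs0
    refine ⟨a, hs a ha, ⟨a, ha, le_rfl, by omega⟩, ?_⟩
    rw [chainLength_eq_zero]
    · exact Nat.zero_le _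
    · intro p hp
      by_contra! h
      exact hge ⟨p, hp, h⟩

lemma exists_max_chainLength {s : Multiset ℕ} (hs : ∀ p ∈ s, 0 < p) (hs0 : s ≠ 0) :
    ∃ e, 1 ≤ e ∧ (∃ a ∈ s, e ≤ a ∧ a ≤ e + 1) ∧
      ∀ e', 1 ≤ e' → chainLength s e' ≤ chainLength s e := by
  obtain ⟨e, he, hmax⟩ := Finset.exists_max_image (Finset.Icc 1 (s.sum + 1)) (chainLength s)
    ⟨1, by simp⟩
  obtain ⟨e', he', hne, hle⟩ := exists_chainLength_ge hs hs0 (Finset.mem_Icc.1 he).1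
  refine ⟨e', he', hne, fun d hd => ?_⟩
  rcases le_or_gt d (s.sum + 1) with h | h
  · exact (hmax d (Finset.mem_Icc.2 ⟨hd, h⟩)).trans hle
  · rw [chainLength_eq_zero]
    · exact Nat.zero_le _
    · intro p hp
      have := Multiset.single_le_sum (fun _ _ => Nat.zero_le _) p hp
      omega

end Candidates

/-! ### Polynomial functions on lines of a linear space -/

section Lines

variable {F : Type*} [Field F] {V : Type*} [AddCommGroup V] [Module F V]

/-- The restriction of `f` to every line is a polynomial function. -/
def IsPolynomialOnLines (f : V → F) : Prop :=
  ∀ x y, ∃ P : Polynomial F, ∀ t : F, f (x + t • y) = P.eval t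

lemma IsPolynomialOnLines.mul {f f' : V → F} (hf : IsPolynomialOnLines f)
    (hf' : IsPolynomialOnLines f') : IsPolynomialOnLines (fun x => f x * f' x) := by
  intro x y
  obtain ⟨P, hP⟩ := hf x y
  obtain ⟨P', hP'⟩ := hf' x y
  exact ⟨P * P', fun t => by simp only [hP, hP', Polynomial.eval_mul]⟩

lemma isPolynomialOnLines_eval {σ : Type*} (L : V →ₗ[F] (σ → F)) (p : MvPolynomial σ F) :
    IsPolynomialOnLines fun x => MvPolynomial.eval (L x) p := by
  intro x y
  refine ⟨MvPolynomial.aeval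
    (fun i => Polynomial.C (L x i) + Polynomial.X * Polynomial.C (L y i)) p, fun t => ?_⟩
  rw [← Polynomial.coe_evalRingHom, MvPolynomial.aeval_def, MvPolynomial.hom_eval₂]
  have hid : (Polynomial.evalRingHom t).comp (algebraMap F (Polynomial F)) = RingHom.id F := by
    ext a
    simp
  rw [hid, MvPolynomial.eval₂_id]
  change MvPolynomial.eval (L (x + t • y)) p = _
  congr 2
  funext i
  simp
  exact mul_comm _ _

/-- On the line through `x` and `x'` both functions are nonzero polynomials, so their product has a
non-root. This plays the role of irreducibility. -/
lemma IsPolynomialOnLines.exists_ne_zero [Infinite F] {f f' : V → F}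
    (hf : IsPolynomialOnLines f) (hf' : IsPolynomialOnLines f') {S : Submodule F V} {x x' : V}
    (hx : x ∈ S) (hx' : x' ∈ S) (hfx : f x ≠ 0) (hfx' : f' x' ≠ 0) :
    ∃ y ∈ S, f y ≠ 0 ∧ f' y ≠ 0 := by
  obtain ⟨P, hP⟩ := hf x (x' - x)
  obtain ⟨P', hP'⟩ := hf' x (x' - x)
  have h0 : P ≠ 0 := by
    rintro rfl
    have := hP 0
    rw [zero_smul, add_zero, Polynomial.eval_zero] at this
    exact hfx this
  have h0' : P' ≠ 0 := by
    rintro rfl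
    have := hP' 1
    rw [one_smul, add_sub_cancel, Polynomial.eval_zero] at this
    exact hfx' this
  obtain ⟨t, ht⟩ : ∃ t, (P * P').eval t ≠ 0 := by
    by_contra! h
    exact mul_ne_zero h0 h0' (Polynomial.funext fun t => by rw [h t, Polynomial.eval_zero])
  rw [Polynomial.eval_mul] at ht
  refine ⟨x + t • (x' - x), S.add_mem hx (S.smul_mem t (S.sub_mem hx' hx)), ?_, ?_⟩
  · rw [hP]; exact left_ne_zero_of_mul ht
  · rw [hP']; exact right_ne_zero_of_mul ht

end Lines

/-! ### Small kernel as an open condition -/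

section Rank

variable {F : Type*} [Field F] {V : Type*} [AddCommGroup V] [Module F V]

/-- `Q` carries the kernel of `T` isomorphically onto a complement of its range. With the converse
estimate below, `det (X + Q) ≠ 0` certifies that `X` has kernel no larger than `T`. -/
lemma exists_perturbation [FiniteDimensional F V] (T : End F V) :
    ∃ Q : End F V, finrank F (LinearMap.range Q) ≤ finrank F (LinearMap.ker T) ∧
      ∀ x, (T + Q) x = 0 → x = 0 := by
  obtain ⟨p, hp⟩ := LinearMap.exists_leftInverse_of_injective (LinearMap.ker T).subtype
    (Submodule.ker_subtype _)
  obtain ⟨D, hD⟩ := Submodule.exists_isCompl (LinearMap.range T)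
  have hfin : finrank F (LinearMap.ker T) = finrank F D := by
    have h1 := Submodule.finrank_add_eq_of_isCompl hD
    have h2 := LinearMap.finrank_range_add_finrank_ker T
    omega
  let e := LinearEquiv.ofFinrankEq _ _ hfin
  let Q : End F V := D.subtype ∘ₗ (e : LinearMap.ker T →ₗ[F] D) ∘ₗ p
  refine ⟨Q, ?_, fun x hx => ?_⟩
  · rw [hfin]
    refine Submodule.finrank_mono ?_
    rintro _ ⟨x, rfl⟩
    exact (e (p x)).2
  · have hTQ : T x = -Q x := eq_neg_of_add_eq_zero_left hx
    have hmem : T x ∈ D := by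
      rw [hTQ]
      exact D.neg_mem (e (p x)).2
    have hT0 : T x = 0 := Submodule.disjoint_def.1 hD.disjoint _ ⟨x, rfl⟩ hmem
    have hQ0 : Q x = 0 := by rw [← neg_eq_zero, ← hTQ, hT0]
    have h1 : p x = x := congrArg Subtype.val (LinearMap.congr_fun hp ⟨x, hT0⟩)
    have h2 : e (p x) = 0 := Subtype.ext hQ0
    rw [LinearEquiv.map_eq_zero_iff] at h2
    rw [← h1, h2]
    rfl

lemma finrank_ker_le_of_perturbation [FiniteDimensional F V] {T Q : End F V}
    (h : ∀ x, (T + Q) x = 0 → x = 0) :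
    finrank F (LinearMap.ker T) ≤ finrank F (LinearMap.range Q) := by
  let f : LinearMap.ker T →ₗ[F] LinearMap.range Q := Q.rangeRestrict ∘ₗ (LinearMap.ker T).subtype
  refine LinearMap.finrank_le_finrank_of_injective (f := f) ?_
  rw [injective_iff_map_eq_zero]
  rintro ⟨x, hx⟩ hfx
  have hQ : Q x = 0 := congrArg Subtype.val hfx
  refine Subtype.ext (h x ?_)
  rw [LinearMap.add_apply, LinearMap.mem_ker.1 hx, hQ, add_zero]

lemma det_ne_zero_iff_forall {n : ℕ} (A : Matrix (Fin n) (Fin n) F) :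
    A.det ≠ 0 ↔ ∀ x, Matrix.toLin' A x = 0 → x = 0 := by
  rw [Ne, ← Matrix.exists_mulVec_eq_zero_iff]
  push Not
  refine forall_congr' fun x => ?_
  rw [Matrix.toLin'_apply]
  tauto

lemma exists_det_perturbation {n : ℕ} (A : Matrix (Fin n) (Fin n) F) :
    ∃ Q : Matrix (Fin n) (Fin n) F, (A + Q).det ≠ 0 ∧ ∀ X : Matrix (Fin n) (Fin n) F,
      (X + Q).det ≠ 0 → finrank F (LinearMap.ker (Matrix.toLin' X)) ≤
        finrank F (LinearMap.ker (Matrix.toLin' A)) := by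
  obtain ⟨Q, hQ, hA⟩ := exists_perturbation (Matrix.toLin' A)
  refine ⟨LinearMap.toMatrix' Q, ?_, fun X hX => ?_⟩
  · rw [det_ne_zero_iff_forall, map_add, Matrix.toLin'_toMatrix']
    exact hA
  · rw [det_ne_zero_iff_forall, map_add, Matrix.toLin'_toMatrix'] at hX
    exact (finrank_ker_le_of_perturbation hX).trans hQ

lemma finrank_ker_conj_le {n : ℕ} {A u v : Matrix (Fin n) (Fin n) F} (huv : u * v = 1) :
    finrank F (LinearMap.ker (Matrix.toLin' (u * A * v))) ≤
      finrank F (LinearMap.ker (Matrix.toLin' A)) := by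
  have hvu : v * u = 1 := mul_eq_one_comm.1 huv
  let f := (Matrix.toLin' v).restrict (p := LinearMap.ker (Matrix.toLin' (u * A * v)))
    (q := LinearMap.ker (Matrix.toLin' A)) (by
      intro x hx
      rw [LinearMap.mem_ker, Matrix.toLin'_apply] at hx ⊢
      have := congrArg v.mulVec hx
      rwa [Matrix.mulVec_mulVec, Matrix.mulVec_zero, mul_assoc, ← mul_assoc v, hvu, one_mul,
        ← Matrix.mulVec_mulVec] at this)
  refine LinearMap.finrank_le_finrank_of_injective (f := f) ?_
  rw [injective_iff_map_eq_zero]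
  rintro ⟨x, hx⟩ hfx
  have h1 : v.mulVec x = 0 := congrArg Subtype.val hfx
  refine Subtype.ext ?_
  change x = 0
  rw [← Matrix.one_mulVec x, ← huv, ← Matrix.mulVec_mulVec, h1, Matrix.mulVec_zero]

lemma HasJordanType.eq_pair {T : End F V} {s : Multiset ℕ} (h : HasJordanType T s)
    (hs : ∀ p ∈ s, 0 < p) {M : ℕ} (hM : 0 < M) (h0 : T ^ M = 0) (h1 : T ^ (M - 1) ≠ 0)
    (hker : finrank F (LinearMap.ker T) = 2) :
    s = {M, finrank F V - M} ∧ M < finrank F V ∧ finrank F V - M ≤ M := by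
  rw [h.finrank_ker hs, Multiset.card_eq_two] at hker
  obtain ⟨a, b, rfl⟩ := hker
  rw [h.pow_eq_zero_iff] at h0
  rw [Ne, h.pow_eq_zero_iff] at h1
  rw [h.finrank_eq]
  simp only [Multiset.insert_eq_cons, Multiset.mem_cons, Multiset.mem_singleton, forall_eq_or_imp,
    forall_eq, Multiset.sum_cons, Multiset.sum_singleton] at *
  rcases Nat.lt_or_ge a M with ha | ha
  · obtain rfl : b = M := by omega
    refine ⟨?_, by omega, by omega⟩
    rw [Nat.add_sub_cancel]
    exact Multiset.cons_swap a b 0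
  · obtain rfl : a = M := by omega
    refine ⟨?_, by omega, by omega⟩
    rw [Nat.add_sub_cancel_left]

end Rank

/-! ### Generic points of the nilpotent commutator -/

lemma exists_pair_of_rNumber_eq_two {n : ℕ} {lam : n.Partition} (h : rNumber lam = 2) :
    ¬ IsAlmostRectangular lam.parts ∧ ∃ c₁ c₂ : Multiset ℕ, c₁ + c₂ = lam.parts ∧ c₁ ≠ 0 ∧ c₂ ≠ 0 ∧
      IsAlmostRectangular c₁ ∧ IsAlmostRectangular c₂ := by
  -- The infimum of an empty set would be 0, so the value 2 is attained.
  have hmem := Nat.sInf_mem (Nat.nonempty_of_sInf_eq_succ h)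
  change rNumber lam ∈ _ at hmem
  rw [h] at hmem
  obtain ⟨c, hc, hsum⟩ := hmem
  rw [Fin.sum_univ_two] at hsum
  refine ⟨fun har => ?_, c 0, c 1, hsum, (hc 0).1, (hc 1).1, (hc 0).2, (hc 1).2⟩
  have h0 : lam.parts ≠ 0 := by
    intro h0
    rw [h0, add_eq_zero] at hsum
    exact (hc 0).1 hsum.1
  have : rNumber lam ≤ 1 := Nat.sInf_le ⟨fun _ => lam.parts, fun _ => ⟨h0, har⟩, by simp⟩
  omega

lemma conj_mem_nilpotentOrbit {F : Type*} [Field F] {n : ℕ} {mu : n.Partition}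
    {A : Matrix (Fin n) (Fin n) F} (hA : A ∈ nilpotentOrbit F mu) (u : GL (Fin n) F) :
    (u : Matrix (Fin n) (Fin n) F) * A * ((u⁻¹ : GL (Fin n) F) : Matrix (Fin n) (Fin n) F) ∈
      nilpotentOrbit F mu := by
  obtain ⟨e, P, rfl⟩ := hA
  refine ⟨e, u * P, ?_⟩
  rw [mul_inv_rev, Units.val_mul, Units.val_mul]
  simp only [mul_assoc]

lemma mem_nilpotentCommutator_iff {F : Type*} [Field F] {n : ℕ} (B A : Matrix (Fin n) (Fin n) F) :
    A ∈ nilpotentCommutator B ↔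
      IsNilpotent (Matrix.toLin' A) ∧ Commute (Matrix.toLin' A) (Matrix.toLin' B) := by
  have h1 : IsNilpotent (Matrix.toLin' A) ↔ IsNilpotent A :=
    IsNilpotent.map_iff (f := Matrix.toLinAlgEquiv' (R := F) (n := Fin n))
      (Matrix.toLinAlgEquiv' (R := F) (n := Fin n)).injective
  rw [h1, commute_iff_eq, Module.End.mul_eq_comp, Module.End.mul_eq_comp, ← Matrix.toLin'_mul,
    ← Matrix.toLin'_mul]
  exact and_congr_right fun _ => (Matrix.toLin'.injective.eq_iff).symm

/-- A polynomial that detects a nonzero power and a small kernel. -/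
lemma exists_mvPolynomial_of_pow_ne_zero {F : Type*} [Field F] {n m : ℕ}
    {Y : Matrix (Fin n) (Fin n) F} (hY : Y ^ m ≠ 0) :
    ∃ q : MvPolynomial (Fin n × Fin n) F,
      (∀ A : Matrix (Fin n) (Fin n) F, MvPolynomial.eval (fun ij => A ij.1 ij.2) q ≠ 0 →
        A ^ m ≠ 0 ∧ finrank F (LinearMap.ker (Matrix.toLin' A)) ≤
          finrank F (LinearMap.ker (Matrix.toLin' Y))) ∧
      MvPolynomial.eval (fun ij => Y ij.1 ij.2) q ≠ 0 := by
  obtain ⟨Q, hQ, hQX⟩ := exists_det_perturbation Y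
  obtain ⟨a, b, hab⟩ : ∃ a b, (Y ^ m) a b ≠ 0 := by
    by_contra! h
    exact hY (Matrix.ext h)
  let X := Matrix.mvPolynomialX (Fin n) (Fin n) F
  have hX : ∀ A : Matrix (Fin n) (Fin n) F,
      (MvPolynomial.eval fun ij : Fin n × Fin n => A ij.1 ij.2).mapMatrix X = A :=
    fun A => Matrix.mvPolynomialX_mapMatrix_eval A
  let q : MvPolynomial (Fin n × Fin n) F :=
    (X ^ m) a b * (X + (MvPolynomial.C : F →+* MvPolynomial (Fin n × Fin n) F).mapMatrix Q).det
  have hq : ∀ A : Matrix (Fin n) (Fin n) F,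
      MvPolynomial.eval (fun ij => A ij.1 ij.2) q = (A ^ m) a b * (A + Q).det := by
    intro A
    have h1 : MvPolynomial.eval (fun ij => A ij.1 ij.2) ((X ^ m) a b) = (A ^ m) a b := by
      rw [← hX A, ← map_pow, hX A]
      rfl
    have h2 : (MvPolynomial.eval fun ij : Fin n × Fin n => A ij.1 ij.2).mapMatrix
        ((MvPolynomial.C : F →+* MvPolynomial (Fin n × Fin n) F).mapMatrix Q) = Q := by
      ext i j
      simp
    rw [map_mul, h1, RingHom.map_det, map_add, hX, h2]
  refine ⟨q, fun A hA => ?_, ?_⟩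
  · rw [hq] at hA
    refine ⟨fun h => left_ne_zero_of_mul hA (by rw [h]; rfl), hQX A (right_ne_zero_of_mul hA)⟩
  · rw [hq]
    exact mul_ne_zero hab hQ

/-- A nilpotent commutator contains a point at which the index is large and the kernel is small, and
up to conjugation such points exist off the zero set of every polynomial that does not vanish on the
nilpotent commutator. -/
lemma exists_generic_of_nilpotentCommutator {F : Type*} [Field F] [IsAlgClosed F] {n m k : ℕ}
    {B A₁ A₂ : Matrix (Fin n) (Fin n) F} (hA₁ : A₁ ∈ nilpotentCommutator B) (hA₁m : A₁ ^ m ≠ 0)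
    (hA₂ : A₂ ∈ nilpotentCommutator B)
    (hA₂k : finrank F (LinearMap.ker (Matrix.toLin' A₂)) ≤ k) :
    ∃ Y ∈ nilpotentCommutator B, Y ^ m ≠ 0 ∧ finrank F (LinearMap.ker (Matrix.toLin' Y)) ≤ k ∧
      ∀ A ∈ nilpotentCommutator B, ∀ p : MvPolynomial (Fin n × Fin n) F,
        MvPolynomial.eval (fun ij => A ij.1 ij.2) p ≠ 0 →
        ∃ (Z : Matrix (Fin n) (Fin n) F) (u : GL (Fin n) F), Z ∈ nilpotentCommutator B ∧
          Z ^ m ≠ 0 ∧ finrank F (LinearMap.ker (Matrix.toLin' Z)) ≤ k ∧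
          (u : Matrix (Fin n) (Fin n) F) * Z * ((u⁻¹ : GL (Fin n) F) : Matrix (Fin n) (Fin n) F) ∈
            nilpotentCommutator B ∧
          MvPolynomial.eval (fun ij => ((u : Matrix (Fin n) (Fin n) F) * Z *
            ((u⁻¹ : GL (Fin n) F) : Matrix (Fin n) (Fin n) F)) ij.1 ij.2) p ≠ 0 := by
  have : Infinite F := IsAlgClosed.instInfinite
  let R := Subalgebra.centralizer F ({B} : Set (Matrix (Fin n) (Fin n) F))
  obtain ⟨S, hSn, hSc⟩ := exists_submodule_isNilpotent F R
  have hR : ∀ A, A ∈ R ↔ B * A = A * B := fun A => by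
    simp [R, Subalgebra.mem_centralizer_iff]
  have hNR : ∀ x : R, IsNilpotent x → (x : Matrix (Fin n) (Fin n) F) ∈ nilpotentCommutator B :=
    fun x hx => ⟨hx.map R.val, ((hR x).1 x.2).symm⟩
  have hRN : ∀ A ∈ nilpotentCommutator B, ∃ x : R, (x : Matrix (Fin n) (Fin n) F) = A ∧
      IsNilpotent x := by
    intro A hA
    refine ⟨⟨A, (hR A).2 hA.2.symm⟩, rfl, ?_⟩
    obtain ⟨r, hr⟩ := hA.1
    exact ⟨r, Subtype.ext hr⟩
  let L : R →ₗ[F] (Fin n × Fin n → F) :=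
    { toFun := fun x ij => (x : Matrix (Fin n) (Fin n) F) ij.1 ij.2
      map_add' := fun _ _ => rfl
      map_smul' := fun _ _ => rfl }
  obtain ⟨x₁, rfl, hx₁⟩ := hRN A₁ hA₁
  obtain ⟨x₂, rfl, hx₂⟩ := hRN A₂ hA₂
  obtain ⟨u₁, hu₁⟩ := hSc x₁ hx₁
  obtain ⟨u₂, hu₂⟩ := hSc x₂ hx₂
  set y₁ : R := (u₁ : R) * x₁ * (↑u₁⁻¹ : R) with hy₁
  set y₂ : R := (u₂ : R) * x₂ * (↑u₂⁻¹ : R) with hy₂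
  have hy₁m : (y₁ : Matrix (Fin n) (Fin n) F) ^ m ≠ 0 := by
    intro h
    have h1 : y₁ ^ m = 0 := Subtype.ext h
    rw [hy₁, Units.conj_pow] at h1
    have h2 : x₁ ^ m = 0 := by
      have := congrArg (fun z : R => (↑u₁⁻¹ : R) * z * (u₁ : R)) h1
      simpa [mul_assoc] using this
    exact hA₁m (congrArg Subtype.val h2)
  have hy₂k : finrank F (LinearMap.ker (Matrix.toLin' (y₂ : Matrix (Fin n) (Fin n) F))) ≤ k := by
    refine le_trans ?_ hA₂k
    have huv : ((u₂ : R) : Matrix (Fin n) (Fin n) F) * ((↑u₂⁻¹ : R) : Matrix (Fin n) (Fin n) F) = 1 :=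
      congrArg Subtype.val (Units.mul_inv u₂)
    exact finrank_ker_conj_le huv
  -- Exponent 0 makes the power condition void: only the kernel condition is wanted for `y₂`.
  have hone : (y₂ : Matrix (Fin n) (Fin n) F) ^ 0 ≠ 0 := by
    intro h
    rw [pow_zero] at h
    exact hy₁m (by rw [← mul_one ((y₁ : Matrix (Fin n) (Fin n) F) ^ m), h, mul_zero])
  obtain ⟨q₁, hq₁, hqy₁⟩ := exists_mvPolynomial_of_pow_ne_zero hy₁m
  obtain ⟨q₂, hq₂, hqy₂⟩ := exists_mvPolynomial_of_pow_ne_zero hone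
  have hf₁ := isPolynomialOnLines_eval L q₁
  have hf₂ := isPolynomialOnLines_eval L q₂
  obtain ⟨y, hyS, hy1, hy2⟩ := hf₁.exists_ne_zero hf₂ hu₁ hu₂ hqy₁ hqy₂
  refine ⟨y, hNR y (hSn y hyS), (hq₁ _ hy1).1, (hq₂ _ hy2).2.trans hy₂k, fun A hA p hp => ?_⟩
  obtain ⟨x, rfl, hx⟩ := hRN A hA
  obtain ⟨u, hu⟩ := hSc x hx
  -- `A` is moved into `S` by conjugation with `u`, and `p` is evaluated after conjugating back, so
  -- that all three conditions are polynomial on the one linear space `S`.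
  let L' : R →ₗ[F] (Fin n × Fin n → F) :=
    L ∘ₗ LinearMap.mulLeft F (↑u⁻¹ : R) ∘ₗ LinearMap.mulRight F (u : R)
  have hL' : ∀ z : R, L' z = L ((↑u⁻¹ : R) * z * (u : R)) := fun z => by
    simp [L', mul_assoc]
  have hpx : MvPolynomial.eval (L' ((u : R) * x * (↑u⁻¹ : R))) p ≠ 0 := by
    rw [hL', show (↑u⁻¹ : R) * ((u : R) * x * (↑u⁻¹ : R)) * (u : R) = x by simp [mul_assoc]]
    exact hp
  obtain ⟨z, hzS, hz12, hz3⟩ := (hf₁.mul hf₂).exists_ne_zero (isPolynomialOnLines_eval L' p)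
    hyS hu (mul_ne_zero hy1 hy2) hpx
  refine ⟨z, Units.map (R.val : R →* Matrix (Fin n) (Fin n) F) u⁻¹, hNR z (hSn z hzS),
    (hq₁ _ (left_ne_zero_of_mul hz12)).1,
    (hq₂ _ (right_ne_zero_of_mul hz12)).2.trans hy₂k, ?_, ?_⟩
  · have hnil : IsNilpotent ((↑u⁻¹ : R) * z * (u : R)) := by
      obtain ⟨r, hr⟩ := hSn z hzS
      have := Units.conj_pow u⁻¹ z r
      rw [inv_inv, hr, mul_zero, zero_mul] at this
      exact ⟨r, this⟩
    exact hNR _ hnil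
  · rw [hL'] at hz3
    exact hz3

end NilpotentPairs

open NilpotentPairs Module in
theorem theorem4p2 {F : Type*} [Field F] [IsAlgClosed F] {n : ℕ} (lam : n.Partition)
    (hr : NilpotentPairs.rNumber lam = 2)
    (B : Matrix (Fin n) (Fin n) F) (hB : B ∈ NilpotentPairs.nilpotentOrbit F lam) :
    ∃ i : ℕ,
      IsGreatest {k : ℕ | ∃ A ∈ NilpotentPairs.nilpotentCommutator B, nilpotencyClass A = k} i ∧
      IsGreatest (NilpotentPairs.indexCandidates lam) i ∧
      i < n ∧ n - i ≤ i ∧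
      ∀ mu : n.Partition,
        NilpotentPairs.IsGenericPartition B mu ↔ mu.parts = {i, n - i} := by
  have hT := (mem_nilpotentOrbit_iff lam B).1 hB
  obtain ⟨hnar, c₁, c₂, hsum, h₁, h₂, hc₁, hc₂⟩ := exists_pair_of_rNumber_eq_two hr
  have hpos : ∀ p ∈ lam.parts, 0 < p := fun p hp => lam.parts_pos hp
  have h0 : lam.parts ≠ 0 := by
    intro h0
    rw [h0, add_eq_zero] at hsum
    exact h₁ hsum.1
  obtain ⟨e, he, hne, hmax⟩ := exists_max_chainLength hpos h0
  set M := chainLength lam.parts e with hMdef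
  have hM : 0 < M := by
    obtain ⟨a, ha, hea, hae⟩ := hne
    refine lt_of_lt_of_le ?_
      (Multiset.single_le_sum (fun _ _ => Nat.zero_le _) _ (Multiset.mem_map_of_mem _ ha))
    rw [chainWeight, if_neg (by omega), if_pos hae]
    omega
  have hmem := mem_nilpotentCommutator_iff B
  have hzero : ∀ A ∈ nilpotentCommutator B, A ^ M = 0 := by
    intro A hA
    obtain ⟨hA1, hA2⟩ := (hmem A).1 hA
    apply Matrix.toLin'.injective
    rw [Matrix.toLin'_pow, hT.pow_eq_zero_of_commute hA1 hA2 hmax, map_zero]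
  have htwo : ∀ A ∈ nilpotentCommutator B, 2 ≤ finrank F (LinearMap.ker (Matrix.toLin' A)) := by
    intro A hA
    obtain ⟨hA1, hA2⟩ := (hmem A).1 hA
    by_contra! hlt
    exact hnar (hT.isAlmostRectangular hpos hA1 hA2 (by omega))
  obtain ⟨A₁, hA₁, hA₁M⟩ : ∃ A ∈ nilpotentCommutator B, A ^ (M - 1) ≠ 0 := by
    obtain ⟨C, hC1, hC2, hC3⟩ := hT.exists_commute_pow_ne_zero he hne
    refine ⟨LinearMap.toMatrix' C, (hmem _).2 (by rw [Matrix.toLin'_toMatrix']; exact ⟨hC1, hC2⟩),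
      fun h => hC3 ?_⟩
    have := congrArg Matrix.toLin' h
    rwa [Matrix.toLin'_pow, Matrix.toLin'_toMatrix', map_zero] at this
  obtain ⟨A₂, hA₂, hA₂k⟩ : ∃ A ∈ nilpotentCommutator B,
      finrank F (LinearMap.ker (Matrix.toLin' A)) ≤ 2 := by
    have hT' := hT
    rw [← hsum] at hT'
    obtain ⟨C, hC1, hC2, hC3⟩ := hT'.exists_commute_finrank_ker_le_two hc₁ hc₂ h₁ h₂
    exact ⟨LinearMap.toMatrix' C, (hmem _).2 (by rw [Matrix.toLin'_toMatrix']; exact ⟨hC1, hC2⟩),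
      by rwa [Matrix.toLin'_toMatrix']⟩
  have htype : ∀ A ∈ nilpotentCommutator B, A ^ (M - 1) ≠ 0 →
      finrank F (LinearMap.ker (Matrix.toLin' A)) ≤ 2 →
      ∀ s : Multiset ℕ, (∀ p ∈ s, 0 < p) → HasJordanType (Matrix.toLin' A) s →
        s = {M, n - M} ∧ M < n ∧ n - M ≤ M := by
    intro A hA hAM hAk s hs hAs
    have h := hAs.eq_pair hs hM (by rw [← Matrix.toLin'_pow, hzero A hA, map_zero])
      (by
        rw [← Matrix.toLin'_pow]
        exact fun h => hAM (Matrix.toLin'.injective (by rw [h, map_zero])))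
      (le_antisymm hAk (htwo A hA))
    rwa [finrank_fin_fun] at h
  obtain ⟨Y₀, hY₀, hY₀M, hY₀k, hdense⟩ := exists_generic_of_nilpotentCommutator hA₁ hA₁M hA₂ hA₂k
  obtain ⟨s₀, hs₀, hs₀pos⟩ := exists_hasJordanType ((hmem _).1 hY₀).1
  obtain ⟨-, hMn, hnM⟩ := htype Y₀ hY₀ hY₀M hY₀k s₀ hs₀pos hs₀
  have horbit : ∀ A ∈ nilpotentCommutator B, A ^ (M - 1) ≠ 0 →
      finrank F (LinearMap.ker (Matrix.toLin' A)) ≤ 2 → ∀ mu : n.Partition,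
      (A ∈ nilpotentOrbit F mu ↔ mu.parts = {M, n - M}) := by
    intro A hA hAM hAk mu
    rw [mem_nilpotentOrbit_iff]
    refine ⟨fun h => (htype A hA hAM hAk _ (fun p hp => mu.parts_pos hp) h).1, fun h => ?_⟩
    obtain ⟨s, hs, hspos⟩ := exists_hasJordanType ((hmem _).1 hA).1
    rw [h, ← (htype A hA hAM hAk s hspos hs).1]
    exact hs
  refine ⟨M, ⟨⟨A₁, hA₁, ?_⟩, ?_⟩, ⟨?_, ?_⟩, hMn, hnM, fun mu => ⟨fun hmu => ?_, fun hmu => ?_⟩⟩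
  · obtain ⟨m, hm⟩ : ∃ m, M = m + 1 := Nat.exists_eq_succ_of_ne_zero hM.ne'
    rw [hm, nilpotencyClass_eq_succ_iff, ← hm]
    refine ⟨hzero A₁ hA₁, ?_⟩
    rwa [hm] at hA₁M
  · rintro k ⟨A, hA, rfl⟩
    exact Nat.sInf_le (hzero A hA)
  · obtain ⟨m, hm, hle⟩ := exists_mem_indexCandidates_ge lam hsum hc₁ hc₂ h₁ h₂ he hne
    obtain ⟨e', he', hle'⟩ := exists_le_chainLength_of_mem_indexCandidates lam hm
    have := hmax e' he'
    rwa [show M = m by omega]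
  · intro m hm
    obtain ⟨e', he', hle'⟩ := exists_le_chainLength_of_mem_indexCandidates lam hm
    exact hle'.trans (hmax e' he')
  -- If another orbit were dense, `q`, nonzero at `Y₀`, would be nonzero at one of its points; but
  -- such a point has type `{M, n - M}`.
  · obtain ⟨q, hq, hqY⟩ := exists_mvPolynomial_of_pow_ne_zero hY₀M
    by_contra hne'
    refine hqY (hmu q (fun A ⟨hA1, hA2⟩ => ?_) Y₀ hY₀)
    by_contra hqA
    obtain ⟨h3, h4⟩ := hq A hqA
    exact hne' ((horbit A hA2 h3 (h4.trans hY₀k) mu).1 hA1)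
  · intro p hp A hA
    by_contra hpA
    obtain ⟨Y, u, hY, hYM, hYk, hconj, hpY⟩ := hdense A hA p hpA
    refine hpY (hp _ ⟨?_, hconj⟩)
    exact conj_mem_nilpotentOrbit ((horbit Y hY hYM hYk mu).2 hmu) u
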